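/- **Theorem.** There is an absolute constant $C>0$ such that the following holds. Let $E$ be a finite set of elements and $(S)_{S\in\mathcal S}$ a finite family of subsets of $E$ whose indices (IDs) are linearly ordered. Let $s,t\ge 2$ be integers such that every set has at most $s$ elements and every element lies in at least one and at most $t$ sets, and let $\Lambda\ge\frac12\log_2(st)$ be real (for instance $\Lambda=\log_2(st)$ or $\Lambda=\log_2 s\cdot\log_2 t$). Then the algorithm below always returns a set cover $\mathcal S_{\mathrm{cvr}}$, and $\mathbb E\,|\mathcal S_{\mathrm{cvr}}|\le C\cdot\log_2 s\cdot \mathrm{OPT}$, where $\mathrm{OPT}$ is the optimal value of a fractional set cover, i.e. the minimum of $\sum_S x_S$ over $x\ge 0$ with $\sum_{S\ni e}x_S\ge1$ for all $e\in E$. *Algorithm.* For $1\le i\le\lceil\log_2 s\rceil$ and $1\le k\le L:=\lceil\log_2 t\rceil$, independently choose for each set $S$ a random subset $B_i(S)\subseteq S$ containing each element of $S$ independently with probability $p_i=\min(1,\Lambda^5\,2^i/s)$, and a random subfamily $\mathcal S_{i,k}\subseteq\mathcal S$ containing each set independently with probability $\min(1,2^k/t)$. The cover is initially empty. At any moment an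 element is *free* if it is neither covered by the current cover nor *pretends* to be covered (once it pretends, it does so until the final clean-up). In stage $i$ put $\hat d(S)=|\{e\in B_i(S): e\text{ free}\}|/p_i$ (with respect to the current state), and call $S$ *large* if $\hat d(S)\ge s/2^i$. Set $\log\log t := \log_2\log_2 t$. All additions within one step are simultaneous. For $i=1,\dots,\lceil\log_2 s\rceil$, stage $i$ does the following: 1. Add every set $S$ such that $B_i(S)$ contains at least $\Lambda^{10}$ elements that are free at the beginning of the stage. 2. For $k=1,\dots,L$ in order: let $\hat{\mathcal S}_k$ be the family of all currently large $S\in\mathcal S_{i,k}$; then every free element contained in at least $\Lambda^{10}\cdot2^{k}$ sets of $\hat{\mathcal S}_k$ pretends to be covered. 3. Run $\mathrm{RecSplit}(1,L,(\hat{\mathcal S}_1,\dots,\hat{\mathcal S}_L))$. $\mathrm{RecSplit}(k',R,(\hat{\mathcal S}_{k'},\dots,\hat{\mathcal S}_{k'+R-1}))$ is the following procedure. If $R\le\max(1,\log\log t)$, then for $k=k',\dots,k'+R-1$ in order, add all sets $S\in\hat{\mathcal S}_k$ that are not yet in the cover and are large at the beginning of iteration $k$. Otherwise let $h=\lfloor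 R/2\rfloor$ and: (a) run $\mathrm{RecSplit}(k',h,(\hat{\mathcal S}_{k'},\dots,\hat{\mathcal S}_{k'+h-1}))$; (b) for $k=k'+h,\dots,k'+R-1$ in order, let $\mathcal S'_k$ be the family of all currently large $S\in\hat{\mathcal S}_k$; then every free element contained in at least $\Lambda^{10}\cdot 2^{k-(k'+h)}$ sets of $\mathcal S'_k$ pretends to be covered; (c) run $\mathrm{RecSplit}(k'+h,R-h,(\mathcal S'_{k'+h},\dots,\mathcal S'_{k'+R-1}))$. After the last stage (clean-up), for each element not covered by the cover, add the set with smallest ID that contains it. Return the resulting family. -/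

import Mathlib

open MeasureTheory ProbabilityTheory

namespace RepeatedSparsification

/-- A set system together with the numerical parameters of the algorithm. The family of sets is
indexed by `ι` (the sets are the vertices on one side of a bipartite graph, with their index as
ID), and `A S` is the set of elements of `E` contained in the set `S`. The number `s` bounds the
sizes of the sets, `t` bounds the number of sets containing an element, and `Λ` is the logarithmic
quantity whose powers `Λ ^ 5` and `Λ ^ 10` are the sampling rate and the cutoff. -/
structure Input (ι E : Type*) where
  A : ι → Finset E
  s : ℕ
  t : ℕ
  Λ : ℝ

section

variable {ι E : Type*} [Fintype ι] [LinearOrder ι] [Fintype E] [DecidableEq E]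

/-- `X` is a set cover: every element lies in a set of `X`. -/
def IsSetCover (A : ι → Finset E) (X : Finset ι) : Prop :=
  ∀ e, ∃ S ∈ X, e ∈ A S

/-- `x` is a fractional set cover. -/
def IsFractionalCover (A : ι → Finset E) (x : ι → ℝ) : Prop :=
  (∀ S, 0 ≤ x S) ∧ ∀ e, 1 ≤ ∑ S with e ∈ A S, x S

/-- The value of an optimal fractional set cover. -/
noncomputable def opt (A : ι → Finset E) : ℝ :=
  sInf {v | ∃ x, IsFractionalCover A x ∧ v = ∑ S, x S}

/-- The number of sets of `X` containing the element `e`. -/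
def elemDegree (A : ι → Finset E) (X : Finset ι) (e : E) : ℕ :=
  {S ∈ X | e ∈ A S}.card

namespace Input

/-- The number `⌈log₂ s⌉` of stages. -/
def stages (I : Input ι E) : ℕ := Nat.clog 2 I.s

/-- The number `⌈log₂ t⌉` of iterations in each stage. -/
def iterations (I : Input ι E) : ℕ := Nat.clog 2 I.t

/-- The probability `p_i` with which an element of `S` is included in `B_i(S)`. -/
noncomputable def sampleProb (I : Input ι E) (i : ℕ) : ℝ :=
  min 1 (I.Λ ^ 5 * (2 ^ i / I.s))

/-- The probability with which a set is included in the family `S_{i,k}`. -/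
noncomputable def familyProb (I : Input ι E) (k : ℕ) : ℝ :=
  min 1 (2 ^ k / I.t)

end Input

/-- The random choices of the algorithm: `B i S` is the sampled subset `B_i(S)` of the set `S`, and
`F i k` is the sampled subfamily `S_{i,k}`. -/
structure Choices (ι E : Type*) where
  B : ℕ → ι → Finset E
  F : ℕ → ℕ → Finset ι

/-- The state of the algorithm: `cover` is the family of the sets added so far, and `free` is the
set of the elements that are neither covered nor pretend to be covered. -/
structure State (ι E : Type*) where
  cover : Finset ι
  free : Finset E

/-- Add all sets of `X` simultaneously to the cover. -/
def State.addSets (A : ι → Finset E) (st : State ι E) (X : Finset ι) : State ι E :=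
  ⟨st.cover ∪ X, st.free \ X.biUnion A⟩

/-- Let all elements of `Y` simultaneously pretend to be covered. -/
def State.pretend (st : State ι E) (Y : Finset E) : State ι E :=
  ⟨st.cover, st.free \ Y⟩

/-- The estimated number of free elements of `S` in stage `i`, in the current state. -/
noncomputable def estDegree (I : Input ι E) (c : Choices ι E) (i : ℕ) (st : State ι E) (S : ι) : ℝ :=
  ((c.B i S ∩ st.free).card : ℝ) / I.sampleProb i

/-- The estimated number of free elements of `S` is at least `s / 2 ^ i`. -/
def IsLarge (I : Input ι E) (c : Choices ι E) (i : ℕ) (st : State ι E) (S : ι) : Prop :=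
  (I.s : ℝ) / 2 ^ i ≤ estDegree I c i st S

open scoped Classical in
/-- One pass of the sparsification loop, for the iteration number `k`: the family `G k` is
restricted to the sets that are currently large, and then every free element contained in at least
`thr k` sets of the resulting family pretends to be covered. -/
noncomputable def sparsifyStep (I : Input ι E) (c : Choices ι E) (i : ℕ) (thr : ℕ → ℝ)
    (x : (ℕ → Finset ι) × State ι E) (k : ℕ) : (ℕ → Finset ι) × State ι E :=
  let G' : Finset ι := {S ∈ x.1 k | IsLarge I c i x.2 S}
  (Function.update x.1 k G',
    x.2.pretend {e ∈ x.2.free | thr k ≤ (elemDegree I.A G' e : ℝ)})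

/-- The sparsification loop `for each k ∈ {k₀, …, k₀ + n - 1}`. -/
noncomputable def sparsify (I : Input ι E) (c : Choices ι E) (i : ℕ) (thr : ℕ → ℝ) (k₀ n : ℕ)
    (G : ℕ → Finset ι) (st : State ι E) : (ℕ → Finset ι) × State ι E :=
  (List.range' k₀ n).foldl (sparsifyStep I c i thr) (G, st)

open scoped Classical in
/-- The procedure `BaseCase`: it executes the iterations `k₀, …, k₀ + R - 1` of stage `i`. -/
noncomputable def baseCase (I : Input ι E) (c : Choices ι E) (i k₀ R : ℕ)
    (G : ℕ → Finset ι) (st : State ι E) : State ι E :=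
  (List.range' k₀ R).foldl
    (fun st k => st.addSets I.A {S ∈ G k | S ∉ st.cover ∧ IsLarge I c i st S}) st

open scoped Classical in
/-- The recursive procedure `RecSplit`: it executes the iterations `k₀, …, k₀ + R - 1` of stage `i`
with the families `G k₀, …, G (k₀ + R - 1)`. It stops splitting once `R ≤ log log t`; a single
iteration cannot be split either. The set of elements that are free at the beginning of a call is
part of the state `st`. -/
noncomputable def recSplit (I : Input ι E) (c : Choices ι E) (i k₀ R : ℕ)
    (G : ℕ → Finset ι) (st : State ι E) : State ι E :=
  if _h : R ≤ 1 ∨ (R : ℝ) ≤ Real.logb 2 (Real.logb 2 I.t) then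
    baseCase I c i k₀ R G st
  else
    let st₁ := recSplit I c i k₀ (R / 2) G st
    let x := sparsify I c i (fun k => I.Λ ^ 10 * 2 ^ (k - (k₀ + R / 2)))
      (k₀ + R / 2) (R - R / 2) G st₁
    recSplit I c i (k₀ + R / 2) (R - R / 2) x.1 x.2
termination_by R
decreasing_by all_goals omega

open scoped Classical in
/-- Stage `i` of the algorithm: the sets with too many free sampled elements are added, the
families `S_{i,k}` are sparsified, and `RecSplit` executes all iterations. -/
noncomputable def stage (I : Input ι E) (c : Choices ι E) (st : State ι E) (i : ℕ) : State ι E :=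
  let st₁ := st.addSets I.A {S | I.Λ ^ 10 ≤ ((c.B i S ∩ st.free).card : ℝ)}
  let x := sparsify I c i (fun k => I.Λ ^ 10 * 2 ^ k) 1 I.iterations (c.F i) st₁
  recSplit I c i 1 I.iterations x.1 x.2

/-- The sets added at the end: for each element that is not covered by `X`, the set with smallest
ID that contains it. -/
def cleanUp (A : ι → Finset E) (X : Finset ι) : Finset ι :=
  {S | ∃ e, (∀ S' ∈ X, e ∉ A S') ∧ e ∈ A S ∧ ∀ S', e ∈ A S' → S ≤ S'}

/-- The family of sets returned by the algorithm, for given outcomes of the random choices. -/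
noncomputable def algorithm (I : Input ι E) (c : Choices ι E) : Finset ι :=
  let st := (List.range' 1 I.stages).foldl (stage I c) ⟨∅, Finset.univ⟩
  st.cover ∪ cleanUp I.A st.cover

/-- The random bits. There is one for each stage `i`, set `S` and element `e` (is `e` included in
`B_i(S)`?), and one for each stage `i`, iteration `k` and set `S` (is `S` included in
`S_{i,k}`?). -/
abbrev Coin (I : Input ι E) : Type _ :=
  (Finset.Icc 1 I.stages × ι × E) ⊕ (Finset.Icc 1 I.stages × Finset.Icc 1 I.iterations × ι)

/-- The probability that a random bit is `true`. -/
noncomputable def coinProb (I : Input ι E) : Coin I → ℝ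
  | .inl x => I.sampleProb x.1
  | .inr x => I.familyProb x.2.1

/-- The joint law of the random bits, which are independent; the clamping `Set.projIcc` to `[0, 1]`
does not change the probabilities, which lie in `[0, 1]`. -/
noncomputable def coinMeasure (I : Input ι E) : Measure (Coin I → Bool) :=
  Measure.pi fun x =>
    bernoulliMeasure true false (Set.projIcc (0 : ℝ) 1 zero_le_one (coinProb I x))

open scoped Classical in
/-- The random choices determined by the random bits. -/
noncomputable def choices (I : Input ι E) (ω : Coin I → Bool) : Choices ι E where
  B i S := {e ∈ I.A S | ∃ hi : i ∈ Finset.Icc 1 I.stages, ω (.inl (⟨i, hi⟩, S, e)) = true}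
  F i k := {S | ∃ (hi : i ∈ Finset.Icc 1 I.stages) (hk : k ∈ Finset.Icc 1 I.iterations),
    ω (.inr (⟨i, hi⟩, ⟨k, hk⟩, S)) = true}

/-- The random family of sets returned by the algorithm. -/
noncomputable def solution (I : Input ι E) (ω : Coin I → Bool) : Finset ι :=
  algorithm I (choices I ω)

/-- The expected number of sets returned by the algorithm. -/
noncomputable def expectedSize (I : Input ι E) : ℝ :=
  ∫ ω, ((solution I ω).card : ℝ) ∂coinMeasure I

end

end RepeatedSparsification

set_option linter.unusedSectionVars false

/-! The algorithm is compared with an idealised process (`ideal`) that has no cut and no pretending: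
in iteration $k$ of stage $i$ it adds every large set of $\mathcal S_{i,k}$. Two things are shown:
the idealised cover has expected size $O(\log s)\cdot\sum_S x_S$ for every fractional cover $x$, and
the algorithm rarely deviates from it at any fixed element or set.

Size of the idealised cover. The sample $B_i(S)$ is reused throughout a stage, yet while $S$ still
has a free element it has not been added in this stage, so the process equals the one with $S$
removed (`ideal_drop_of_not_disjoint`), which is independent of $B_i(S)$. Exponential tail bounds
then make the estimates reliable: a large set has at least $\frac14 s/2^i$ free elements
(`Pr_large_of_few_free_le`), and, since the last iteration samples every set, each set enters the
next stage with at most $4s/2^i$ free elements (`Pr_many_free_le`). Charge each added set to its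
free elements. The sampling rates at most double between iterations, so the expected number of sets
hitting a free element is bounded by the probability of having been hit one iteration earlier; this
telescopes to a constant (`sum_load_le`). Weighting the free elements by $x$ gives $O(\sum_S x_S)$
per stage.

Comparison. In the idealised process an element in too many large sets would already have been
covered, so pretending needs an event of probability at most $2e^{-\Lambda^5/2}$ (`Pr_pretend_le`);
a cut is equally unlikely (`Pr_cut_le`). Whether a step treats an element or a set correctly depends
only on the sets containing it and on their elements, so a local union bound multiplies the
deviation probability by at most $2+t+st=e^{O(\Lambda)}$ per step (`Close.step`). There are
$O(\log^2 t\cdot\log s)=O(\Lambda^3)$ steps, hence a total factor $e^{O(\Lambda^4)}$, which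
$e^{-\Lambda^5/2}$ absorbs once $\Lambda\ge600$. The remaining deviation is far below $1/(st)$, so
summing it over all elements and nonempty sets costs only $O(\sum_S x_S)$ (`expectedSize_le_ideal`).
For $\Lambda\le600$ the product $st$ is bounded, and the number of nonempty sets suffices as a
bound. -/

namespace RepeatedSparsification

/-! ### Expectations over independent random bits -/

section Expectation

variable {κ : Type*} [Fintype κ] [DecidableEq κ]

/-- The weight of a single bit. -/
def bitWeight (q : ℝ) (b : Bool) : ℝ := if b then q else 1 - q

/-- The expectation of `f` over independent bits that are `true` with probabilities `p`. -/
def Ex (p : κ → ℝ) (f : (κ → Bool) → ℝ) : ℝ :=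
  ∑ ω, (∏ c, bitWeight (p c) (ω c)) * f ω

open scoped Classical in
/-- The probability of the event `P`. -/
noncomputable def Pr (p : κ → ℝ) (P : (κ → Bool) → Prop) : ℝ :=
  Ex p fun ω => if P ω then 1 else 0

variable {p : κ → ℝ}

theorem Pr_eq_Ex (P : (κ → Bool) → Prop) [DecidablePred P] :
    Pr p P = Ex p fun ω => if P ω then 1 else 0 := by
  simp only [Pr, Ex]
  congr!

theorem Ex_congr {f g : (κ → Bool) → ℝ} (h : ∀ ω, f ω = g ω) : Ex p f = Ex p g := by
  simp [Ex, h]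

theorem Ex_add (f g : (κ → Bool) → ℝ) : Ex p (fun ω => f ω + g ω) = Ex p f + Ex p g := by
  simp [Ex, mul_add, Finset.sum_add_distrib]

theorem Ex_sub (f g : (κ → Bool) → ℝ) : Ex p (fun ω => f ω - g ω) = Ex p f - Ex p g := by
  simp [Ex, mul_sub, Finset.sum_sub_distrib]

theorem Ex_const_mul (a : ℝ) (f : (κ → Bool) → ℝ) : Ex p (fun ω => a * f ω) = a * Ex p f := by
  simp only [Ex, Finset.mul_sum]
  exact Finset.sum_congr rfl fun ω _ => by ring

theorem Ex_mul_const (a : ℝ) (f : (κ → Bool) → ℝ) : Ex p (fun ω => f ω * a) = Ex p f * a := by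
  rw [mul_comm, ← Ex_const_mul]
  exact Ex_congr fun ω => mul_comm _ _

theorem Ex_sum {J : Type*} (s : Finset J) (f : J → (κ → Bool) → ℝ) :
    Ex p (fun ω => ∑ j ∈ s, f j ω) = ∑ j ∈ s, Ex p (f j) := by
  simp only [Ex, Finset.mul_sum]
  exact Finset.sum_comm

theorem Ex_const (a : ℝ) : Ex p (fun _ => a) = a := by
  have h : ∑ ω : κ → Bool, ∏ c, bitWeight (p c) (ω c) = 1 := by
    have h := Finset.prod_univ_sum (fun _ : κ => (Finset.univ : Finset Bool))
      (fun c b => bitWeight (p c) b)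
    rw [Fintype.piFinset_univ] at h
    rw [← h]
    exact Finset.prod_eq_one fun c _ => by simp [bitWeight]
  rw [Ex, ← Finset.sum_mul, h, one_mul]

theorem Ex_mono (hp : ∀ c, p c ∈ Set.Icc (0 : ℝ) 1) {f g : (κ → Bool) → ℝ}
    (h : ∀ ω, f ω ≤ g ω) : Ex p f ≤ Ex p g := by
  refine Finset.sum_le_sum fun ω _ => mul_le_mul_of_nonneg_left (h ω) ?_
  refine Finset.prod_nonneg fun c _ => ?_
  rw [bitWeight]
  split_ifs
  · exact (hp c).1
  · linarith [(hp c).2]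

theorem Ex_nonneg (hp : ∀ c, p c ∈ Set.Icc (0 : ℝ) 1) {f : (κ → Bool) → ℝ}
    (h : ∀ ω, 0 ≤ f ω) : 0 ≤ Ex p f := by
  simpa [Ex_const] using Ex_mono hp (f := fun _ => 0) h

theorem Pr_nonneg (hp : ∀ c, p c ∈ Set.Icc (0 : ℝ) 1) (P : (κ → Bool) → Prop) : 0 ≤ Pr p P :=
  Ex_nonneg hp fun ω => by split_ifs <;> simp

theorem Pr_le_Ex (hp : ∀ c, p c ∈ Set.Icc (0 : ℝ) 1) {P : (κ → Bool) → Prop}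
    {f : (κ → Bool) → ℝ} (h : ∀ ω, P ω → 1 ≤ f ω) (h0 : ∀ ω, 0 ≤ f ω) : Pr p P ≤ Ex p f :=
  Ex_mono hp fun ω => by
    split_ifs with hω
    · exact h ω hω
    · exact h0 ω

theorem Pr_mono (hp : ∀ c, p c ∈ Set.Icc (0 : ℝ) 1) {P Q : (κ → Bool) → Prop}
    (h : ∀ ω, P ω → Q ω) : Pr p P ≤ Pr p Q :=
  Pr_le_Ex hp (fun ω hω => by simp [h ω hω]) fun ω => by split_ifs <;> simp

theorem Pr_or_le (hp : ∀ c, p c ∈ Set.Icc (0 : ℝ) 1) (P Q : (κ → Bool) → Prop) :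
    Pr p (fun ω => P ω ∨ Q ω) ≤ Pr p P + Pr p Q := by
  rw [Pr, Pr, Pr, ← Ex_add]
  refine Ex_mono hp fun ω => ?_
  by_cases h1 : P ω <;> by_cases h2 : Q ω <;> simp [h1, h2]

theorem Pr_exists_le (hp : ∀ c, p c ∈ Set.Icc (0 : ℝ) 1) {J : Type*} (s : Finset J)
    (P : J → (κ → Bool) → Prop) :
    Pr p (fun ω => ∃ j ∈ s, P j ω) ≤ ∑ j ∈ s, Pr p (P j) := by
  classical
  simp only [Pr]
  rw [← Ex_sum]
  refine Ex_mono hp fun ω => ?_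
  split_ifs with h
  · obtain ⟨j, hj, hP⟩ := h
    refine le_trans ?_ (Finset.single_le_sum (fun j _ => ?_) hj)
    · simp [hP]
    · split_ifs <;> simp
  · exact Finset.sum_nonneg fun j _ => by split_ifs <;> simp

theorem Pr_exists_le_mul (hp : ∀ c, p c ∈ Set.Icc (0 : ℝ) 1) {J : Type*} (s : Finset J)
    (P : J → (κ → Bool) → Prop) {m : ℕ} {a : ℝ} (hs : s.card ≤ m) (ha : 0 ≤ a)
    (h : ∀ j ∈ s, Pr p (P j) ≤ a) :
    Pr p (fun ω => ∃ j ∈ s, P j ω) ≤ m * a := by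
  refine (Pr_exists_le hp s P).trans ((Finset.sum_le_sum h).trans ?_)
  rw [Finset.sum_const, nsmul_eq_mul]
  exact mul_le_mul_of_nonneg_right (by exact_mod_cast hs) ha

theorem Pr_eq_zero {P : (κ → Bool) → Prop} (h : ∀ ω, ¬ P ω) : Pr p P = 0 := by
  simp [Pr, Ex, h]

/-- A factor that depends only on the bit `c` is independent of the other bits. -/
theorem Ex_mul_bit {h : (κ → Bool) → ℝ} (c : κ)
    (hh : ∀ ω b, h (Function.update ω c b) = h ω) (g : Bool → ℝ) :
    Ex p (fun ω => h ω * g (ω c)) = Ex p h * (p c * g true + (1 - p c) * g false) := by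
  set R : (κ → Bool) → ℝ := fun ω => ∏ c' ∈ Finset.univ.erase c, bitWeight (p c') (ω c')
  have hR : ∀ ω b, R (Function.update ω c b) = R ω := fun ω b => by
    refine Finset.prod_congr rfl fun c' hc' => ?_
    rw [Function.update_of_ne (Finset.ne_of_mem_erase hc')]
  have hW : ∀ ω : κ → Bool, ∏ c, bitWeight (p c) (ω c) = bitWeight (p c) (ω c) * R ω := fun ω =>
    (Finset.mul_prod_erase _ _ (Finset.mem_univ c)).symm
  -- Flipping the bit `c` is an involution that fixes `R` and `h`; averaging the sum with its
  -- flipped copy replaces `u (ω c)` by a constant.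
  have key : ∀ u : Bool → ℝ,
      2 * ∑ ω, R ω * h ω * u (ω c) = (u true + u false) * ∑ ω, R ω * h ω := by
    intro u
    have hinv : Function.Involutive fun ω : κ → Bool => Function.update ω c (!ω c) := by
      intro ω; simp
    have h1 : ∑ ω, R ω * h ω * u (ω c) = ∑ ω, R ω * h ω * u (!ω c) := by
      rw [← Equiv.sum_comp hinv.toPerm]
      exact Finset.sum_congr rfl fun ω _ => by
        simp [Function.Involutive.toPerm, hR, hh]
    rw [two_mul]
    nth_rewrite 2 [h1]
    rw [← Finset.sum_add_distrib, Finset.mul_sum]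
    refine Finset.sum_congr rfl fun ω _ => ?_
    cases ω c <;> simp <;> ring
  have k1 := key fun b => bitWeight (p c) b * g b
  have k2 := key fun b => bitWeight (p c) b
  have e1 : Ex p (fun ω => h ω * g (ω c)) =
      ∑ ω, R ω * h ω * (bitWeight (p c) (ω c) * g (ω c)) :=
    Finset.sum_congr rfl fun ω _ => by rw [hW]; ring
  have e2 : Ex p h = ∑ ω, R ω * h ω * bitWeight (p c) (ω c) :=
    Finset.sum_congr rfl fun ω _ => by rw [hW]; ring
  rw [e1, e2]
  simp only [bitWeight, if_true, Bool.false_eq_true, if_false] at k1 k2 ⊢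
  linear_combination k1 / 2 - (p c * g true + (1 - p c) * g false) * k2 / 2

/-! ### Tail bounds for blocks of equally distributed bits. -/

section Block

variable {J : Type*} [DecidableEq J] {y : J → κ}

/-- `f` does not depend on the bits in the range of `y`. -/
def IndepOf {α : Type*} (y : J → κ) (f : (κ → Bool) → α) : Prop :=
  ∀ ω ω', (∀ c, c ∉ Set.range y → ω c = ω' c) → f ω = f ω'

theorem IndepOf.comp {α β : Type*} {f : (κ → Bool) → α} (hf : IndepOf y f) (g : α → β) :
    IndepOf y fun ω => g (f ω) := fun ω ω' h => congrArg g (hf ω ω' h)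

theorem IndepOf.update {α : Type*} {f : (κ → Bool) → α} (hf : IndepOf y f) (j : J)
    (ω : κ → Bool) (b : Bool) : f (Function.update ω (y j) b) = f ω :=
  hf _ _ fun _ hc => Function.update_of_ne (fun h => hc ⟨j, h.symm⟩) _ _

/-- The factors of a product over a random index set that is independent of the block of bits
may be replaced by their means. -/
theorem Ex_mul_prod_block (hy : Function.Injective y) {q : ℝ} (hq : ∀ j, p (y j) = q)
    {φ : (κ → Bool) → ℝ} {N : (κ → Bool) → Finset J} (hφ : IndepOf y φ) (hN : IndepOf y N)
    (g : Bool → ℝ) :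
    Ex p (fun ω => φ ω * ∏ j ∈ N ω, g (ω (y j))) =
      Ex p (fun ω => φ ω * (q * g true + (1 - q) * g false) ^ (N ω).card) := by
  classical
  set m := q * g true + (1 - q) * g false
  -- Hybrid argument: `T` is the set of indices whose factor has already been replaced by the mean
  -- `m`. Each step splits on whether the next index lies in `N ω` and integrates out one bit.
  have key : ∀ T : Finset J, Ex p (fun ω => φ ω * ∏ j ∈ N ω, g (ω (y j))) =
      Ex p (fun ω => φ ω * ∏ j ∈ N ω, if j ∈ T then m else g (ω (y j))) := by
    intro T
    induction T using Finset.induction_on with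
    | empty => simp
    | insert j₀ T hj₀ ih =>
      rw [ih]
      set h : (κ → Bool) → ℝ := fun ω =>
        φ ω * ∏ j ∈ (N ω).erase j₀, if j ∈ T then m else g (ω (y j)) with hh
      have hinv : ∀ ω b, h (Function.update ω (y j₀) b) = h ω := by
        intro ω b
        simp only [hh]
        rw [hφ.update, hN.update]
        congr 1
        refine Finset.prod_congr rfl fun j hj => ?_
        rw [Function.update_of_ne (fun h => Finset.ne_of_mem_erase hj (hy h))]
      have e1 : ∀ ω, φ ω * ∏ j ∈ N ω, (if j ∈ T then m else g (ω (y j))) =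
          (if j₀ ∈ N ω then h ω else 0) * g (ω (y j₀)) + if j₀ ∈ N ω then 0 else h ω := by
        intro ω
        by_cases hj : j₀ ∈ N ω
        · simp only [hj, if_true, hh]
          rw [← Finset.mul_prod_erase _ _ hj]
          simp [hj₀]; ring
        · simp [hj, hh, Finset.erase_eq_of_notMem]
      have e2 : ∀ ω, φ ω * ∏ j ∈ N ω, (if j ∈ insert j₀ T then m else g (ω (y j))) =
          (if j₀ ∈ N ω then h ω else 0) * m + if j₀ ∈ N ω then 0 else h ω := by
        intro ω
        have e3 : ∏ j ∈ (N ω).erase j₀, (if j ∈ insert j₀ T then m else g (ω (y j))) =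
            ∏ j ∈ (N ω).erase j₀, if j ∈ T then m else g (ω (y j)) :=
          Finset.prod_congr rfl fun j hj => by
            simp [Finset.mem_insert, Finset.ne_of_mem_erase hj]
        by_cases hj : j₀ ∈ N ω
        · simp only [hj, if_true, hh]
          rw [← Finset.mul_prod_erase _ _ hj, e3]
          simp; ring
        · rw [Finset.erase_eq_of_notMem hj] at e3
          rw [e3]
          simp [hj, hh, Finset.erase_eq_of_notMem]
      rw [Ex_congr e1, Ex_congr e2, Ex_add, Ex_add, Ex_mul_const, Ex_mul_bit, hq]
      intro ω b
      rw [hN.update, hinv]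
  -- This `T` is all of `J`, which is finite because `y` embeds it into `κ`.
  rw [key (Finset.univ.filter (fun c => c ∈ Set.range y) |>.preimage y hy.injOn)]
  refine Ex_congr fun ω => ?_
  rw [Finset.prod_congr rfl (g := fun _ => m) fun j _ => by simp, Finset.prod_const]

theorem prod_bool_eq_pow (N : Finset J) (ω : κ → Bool) (z : ℝ) :
    ∏ j ∈ N, (if ω (y j) = true then z else 1) = z ^ {j ∈ N | ω (y j) = true}.card := by
  rw [Finset.prod_ite]; simp

/-- An exponential upper tail bound for the number of successes in a random index set. -/
theorem Ex_upper_tail (hp : ∀ c, p c ∈ Set.Icc (0 : ℝ) 1) (hy : Function.Injective y) {q : ℝ}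
    (hq0 : 0 ≤ q) (hq : ∀ j, p (y j) = q) {φ : (κ → Bool) → Prop} {N : (κ → Bool) → Finset J}
    (hφ : IndepOf y φ) (hN : IndepOf y N) {a b : ℝ} (hb : ∀ ω, φ ω → 2 * q * (N ω).card ≤ b) :
    Pr p (fun ω => φ ω ∧ a ≤ ({j ∈ N ω | ω (y j) = true}.card : ℝ)) ≤ Real.exp (b - a) := by
  classical
  have h1 := Ex_mul_prod_block (p := p) hy hq (hφ.comp fun P => if P then (1 : ℝ) else 0) hN
    (fun b => if b = true then Real.exp 1 else 1)
  simp only [prod_bool_eq_pow] at h1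
  calc _ ≤ Ex p (fun ω => Real.exp (-a) * ((if φ ω then 1 else 0) *
        Real.exp 1 ^ {j ∈ N ω | ω (y j) = true}.card)) := by
        refine Pr_le_Ex hp (fun ω hω => ?_) fun ω => by split_ifs <;> positivity
        rw [if_pos hω.1, one_mul, ← Real.exp_nat_mul, ← Real.exp_add]
        exact Real.one_le_exp (by linarith [hω.2])
    _ = Real.exp (-a) * Ex p (fun ω => (if φ ω then 1 else 0) *
        (q * Real.exp 1 + (1 - q) * 1) ^ (N ω).card) := by
        rw [Ex_const_mul, h1]; simp
    _ ≤ Real.exp (-a) * Ex p (fun _ => Real.exp b) := by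
        refine mul_le_mul_of_nonneg_left (Ex_mono hp fun ω => ?_) (Real.exp_nonneg _)
        split_ifs with hω
        · rw [one_mul]
          -- Since $e-1\le2$, the moment generating factor $1+q(e-1)$ is at most $1+2q\le e^{2q}$.
          have h2 : q * Real.exp 1 + (1 - q) * 1 ≤ Real.exp (2 * q) := by
            have := Real.add_one_le_exp (2 * q)
            nlinarith [Real.exp_one_lt_d9]
          have h3 : (0 : ℝ) ≤ q * Real.exp 1 + (1 - q) * 1 := by
            nlinarith [Real.exp_one_gt_d9]
          refine (pow_le_pow_left₀ h3 h2 _).trans ?_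
          rw [← Real.exp_nat_mul]
          exact Real.exp_le_exp.2 (by linarith [hb ω hω])
        · rw [zero_mul]; exact Real.exp_nonneg _
    _ = Real.exp (b - a) := by
        rw [Ex_const, ← Real.exp_add]; congr 1; ring

/-- An exponential lower tail bound for the number of successes in a random index set. -/
theorem Ex_lower_tail (hp : ∀ c, p c ∈ Set.Icc (0 : ℝ) 1) (hy : Function.Injective y) {q : ℝ}
    (hq0 : 0 ≤ q) (hq1 : q ≤ 1) (hq : ∀ j, p (y j) = q) {φ : (κ → Bool) → Prop}
    {N : (κ → Bool) → Finset J} (hφ : IndepOf y φ) (hN : IndepOf y N) {a b : ℝ}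
    (hb : ∀ ω, φ ω → b ≤ q / 2 * (N ω).card) :
    Pr p (fun ω => φ ω ∧ ({j ∈ N ω | ω (y j) = true}.card : ℝ) ≤ a) ≤ Real.exp (a - b) := by
  classical
  have h1 := Ex_mul_prod_block (p := p) hy hq (hφ.comp fun P => if P then (1 : ℝ) else 0) hN
    (fun b => if b = true then Real.exp (-1) else 1)
  simp only [prod_bool_eq_pow] at h1
  calc _ ≤ Ex p (fun ω => Real.exp a * ((if φ ω then 1 else 0) *
        Real.exp (-1) ^ {j ∈ N ω | ω (y j) = true}.card)) := by
        refine Pr_le_Ex hp (fun ω hω => ?_) fun ω => by split_ifs <;> positivity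
        rw [if_pos hω.1, one_mul, ← Real.exp_nat_mul, ← Real.exp_add]
        exact Real.one_le_exp (by linarith [hω.2])
    _ = Real.exp a * Ex p (fun ω => (if φ ω then 1 else 0) *
        (q * Real.exp (-1) + (1 - q) * 1) ^ (N ω).card) := by
        rw [Ex_const_mul, h1]; simp
    _ ≤ Real.exp a * Ex p (fun _ => Real.exp (-b)) := by
        refine mul_le_mul_of_nonneg_left (Ex_mono hp fun ω => ?_) (Real.exp_nonneg _)
        split_ifs with hω
        · rw [one_mul]
          have h4 : Real.exp (-1) ≤ 1 / 2 := by
            rw [Real.exp_neg, one_div]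
            exact inv_anti₀ (by norm_num) (by linarith [Real.exp_one_gt_d9])
          -- From $e^{-1}\le\frac12$, the factor is at most $1-q/2$.
          have h2 : q * Real.exp (-1) + (1 - q) * 1 ≤ Real.exp (-(q / 2)) := by
            have := Real.add_one_le_exp (-(q / 2))
            nlinarith
          have h3 : (0 : ℝ) ≤ q * Real.exp (-1) + (1 - q) * 1 := by
            have := Real.exp_nonneg (-1)
            have := mul_nonneg hq0 this
            linarith
          refine (pow_le_pow_left₀ h3 h2 _).trans ?_
          rw [← Real.exp_nat_mul]
          exact Real.exp_le_exp.2 (by linarith [hb ω hω])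
        · rw [zero_mul]; exact Real.exp_nonneg _
    _ = Real.exp (a - b) := by
        rw [Ex_const, ← Real.exp_add]; congr 1

theorem Ex_mul_no_success (hy : Function.Injective y) {q : ℝ} (hq : ∀ j, p (y j) = q)
    {φ : (κ → Bool) → ℝ} {N : (κ → Bool) → Finset J} (hφ : IndepOf y φ) (hN : IndepOf y N) :
    Ex p (fun ω => φ ω * if ∀ j ∈ N ω, ω (y j) = false then 1 else 0) =
      Ex p (fun ω => φ ω * (1 - q) ^ (N ω).card) := by
  have h1 := Ex_mul_prod_block (p := p) hy hq hφ hN (fun b => if b = false then 1 else 0)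
  simp only [Finset.prod_ite_zero, Finset.prod_const_one] at h1
  rw [h1]; simp

theorem Ex_mul_successes [Fintype J] {q : ℝ} (hq : ∀ j, p (y j) = q)
    {φ : (κ → Bool) → ℝ} {N : (κ → Bool) → Finset J} (hφ : IndepOf y φ) (hN : IndepOf y N) :
    Ex p (fun ω => φ ω * ({j ∈ N ω | ω (y j) = true}.card : ℝ)) =
      Ex p (fun ω => φ ω * (q * (N ω).card)) := by
  have e1 : ∀ ω, φ ω * ({j ∈ N ω | ω (y j) = true}.card : ℝ) =
      ∑ j, (if j ∈ N ω then φ ω else 0) * (if ω (y j) = true then 1 else 0) := by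
    intro ω
    rw [Finset.card_filter, Nat.cast_sum, Finset.mul_sum]
    simp only [ite_mul, zero_mul, Finset.sum_ite_mem, Finset.univ_inter]
    simp
  have e2 : ∀ ω, φ ω * (q * (N ω).card) = ∑ j, (if j ∈ N ω then φ ω else 0) * q := by
    intro ω
    simp only [ite_mul, zero_mul, Finset.sum_ite_mem, Finset.univ_inter, Finset.sum_const,
      nsmul_eq_mul]
    ring
  rw [Ex_congr e1, Ex_congr e2, Ex_sum, Ex_sum]
  refine Finset.sum_congr rfl fun j _ => ?_
  rw [Ex_mul_bit (y j) (fun ω b => by rw [hN.update, hφ.update])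
    (fun b => if b = true then 1 else 0), Ex_mul_const, hq]
  simp

end Block

end Expectation

/-! ### Regular inputs, the idealised process and its dependence on the random bits. -/

section Dynamics

variable {ι E : Type*} [Fintype ι] [LinearOrder ι] [Fintype E] [DecidableEq E]

/-- The standing assumptions on the input. -/
structure Regular (I : Input ι E) : Prop where
  two_le_s : 2 ≤ I.s
  two_le_t : 2 ≤ I.t
  card_le : ∀ S, (I.A S).card ≤ I.s
  degree_le : ∀ e, elemDegree I.A Finset.univ e ≤ I.t
  one_le : 1 ≤ I.Λ

namespace Regular

variable {I : Input ι E} (hI : Regular I)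
include hI

theorem s_pos : (0 : ℝ) < I.s := by
  have := hI.two_le_s
  exact_mod_cast (by omega : 0 < I.s)

theorem t_pos : (0 : ℝ) < I.t := by
  have := hI.two_le_t
  exact_mod_cast (by omega : 0 < I.t)

theorem Λ_pos : 0 < I.Λ := lt_of_lt_of_le one_pos hI.one_le

theorem sampleProb_pos (i : ℕ) : 0 < I.sampleProb i := by
  have := hI.s_pos
  have := hI.Λ_pos
  exact lt_min one_pos (by positivity)

theorem familyProb_pos (k : ℕ) : 0 < I.familyProb k := by
  have := hI.t_pos
  exact lt_min one_pos (by positivity)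

theorem coinProb_mem (x : Coin I) : coinProb I x ∈ Set.Icc (0 : ℝ) 1 := by
  rcases x with x | x
  · exact ⟨(hI.sampleProb_pos _).le, min_le_left _ _⟩
  · exact ⟨(hI.familyProb_pos _).le, min_le_left _ _⟩

theorem expectedSize_eq :
    expectedSize I = Ex (coinProb I) fun ω => ((solution I ω).card : ℝ) := by
  have key : ∀ ω : Coin I → Bool,
      (coinMeasure I).real {ω} = ∏ c, bitWeight (coinProb I c) (ω c) := by
    intro ω
    rw [Measure.real, coinMeasure, Measure.pi_singleton, ENNReal.toReal_prod]
    refine Finset.prod_congr rfl fun c _ => ?_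
    have h := bernoulliMeasure_real_apply (x := true) (y := false)
      (Set.projIcc (0 : ℝ) 1 zero_le_one (coinProb I c)) (MeasurableSet.singleton (ω c))
    rw [Measure.real] at h
    rw [h, Set.projIcc_of_mem _ (hI.coinProb_mem c)]
    cases ω c <;> simp [bitWeight]
  have : IsProbabilityMeasure (coinMeasure I) := by
    unfold coinMeasure; infer_instance
  rw [expectedSize, integral_fintype (Integrable.of_finite)]
  simp [Ex, key]

end Regular

theorem IsLarge.mono {I : Input ι E} {c : Choices ι E} {i : ℕ} {st st' : State ι E} {S : ι}
    (hI : Regular I) (hst : st'.free ⊆ st.free) (h : IsLarge I c i st' S) :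
    IsLarge I c i st S := by
  refine le_trans (show _ ≤ estDegree I c i st' S from h) ?_
  have := (hI.sampleProb_pos i).le
  unfold estDegree
  gcongr

theorem isLarge_iff {I : Input ι E} {c : Choices ι E} {i : ℕ} {st : State ι E} {S : ι}
    (hI : Regular I) :
    IsLarge I c i st S ↔ (I.s : ℝ) / 2 ^ i * I.sampleProb i ≤ ((c.B i S ∩ st.free).card : ℝ) := by
  rw [IsLarge, estDegree, le_div_iff₀ (hI.sampleProb_pos i)]

theorem IsLarge.nonempty {I : Input ι E} {c : Choices ι E} {i : ℕ} {st : State ι E} {S : ι}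
    (hI : Regular I) (h : IsLarge I c i st S) : (c.B i S ∩ st.free).Nonempty := by
  rw [isLarge_iff hI] at h
  rw [← Finset.card_pos]
  have h1 := hI.s_pos
  have h2 := hI.sampleProb_pos i
  have h3 : (0 : ℝ) < (I.s : ℝ) / 2 ^ i * I.sampleProb i := by positivity
  exact_mod_cast h3.trans_le h

theorem IsLarge.congr {I : Input ι E} {c c' : Choices ι E} {i : ℕ} {st st' : State ι E} {S : ι}
    (h : c.B i S ∩ st.free = c'.B i S ∩ st'.free) :
    IsLarge I c i st S ↔ IsLarge I c' i st' S := by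
  rw [IsLarge, IsLarge, estDegree, estDegree, h]

/-- The sampled subsets are subsets. -/
def Choices.Proper (I : Input ι E) (c : Choices ι E) : Prop := ∀ i S, c.B i S ⊆ I.A S

theorem IsLarge.not_disjoint {I : Input ι E} {c : Choices ι E} {i : ℕ} {st : State ι E} {S : ι}
    (hI : Regular I) (hc : c.Proper I) (h : IsLarge I c i st S) : ¬ Disjoint (I.A S) st.free := by
  rw [Finset.not_disjoint_iff_nonempty_inter]
  exact (h.nonempty hI).mono (Finset.inter_subset_inter_right (hc i S))

theorem mem_addSets_free {A : ι → Finset E} {st : State ι E} {X : Finset ι} {e : E} :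
    e ∈ (st.addSets A X).free ↔ e ∈ st.free ∧ ∀ S ∈ X, e ∉ A S := by
  simp [State.addSets]

/-! ### The idealised process -/

open scoped Classical in
/-- An iteration of the idealised process, in which elements never pretend to be covered. -/
noncomputable def idealStep (I : Input ι E) (c : Choices ι E) (i k : ℕ) (st : State ι E) :
    State ι E :=
  st.addSets I.A {S ∈ c.F i k | IsLarge I c i st S}

/-- The first iterations of stage `i` of the idealised process. -/
noncomputable def idealStage (I : Input ι E) (c : Choices ι E) (i : ℕ) (st : State ι E) :
    ℕ → State ι E
  | 0 => st
  | n + 1 => idealStep I c i (n + 1) (idealStage I c i st n)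

/-- The state of the idealised process after the given number of stages. -/
noncomputable def idealStart (I : Input ι E) (c : Choices ι E) : ℕ → State ι E
  | 0 => ⟨∅, Finset.univ⟩
  | i + 1 => idealStage I c (i + 1) (idealStart I c i) I.iterations

/-- The state of the idealised process after `n` iterations of stage `i + 1`. -/
noncomputable def ideal (I : Input ι E) (c : Choices ι E) (i n : ℕ) : State ι E :=
  idealStage I c (i + 1) (idealStart I c i) n

variable {I : Input ι E} {c c' : Choices ι E}

theorem ideal_succ (i n : ℕ) :
    ideal I c i (n + 1) = idealStep I c (i + 1) (n + 1) (ideal I c i n) := rfl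

theorem ideal_iterations (i : ℕ) : ideal I c i I.iterations = ideal I c (i + 1) 0 := rfl

theorem ideal_succ_free_subset (i n : ℕ) : (ideal I c i (n + 1)).free ⊆ (ideal I c i n).free :=
  Finset.sdiff_subset

theorem ideal_free_antitone (i : ℕ) : Antitone fun n => (ideal I c i n).free :=
  antitone_nat_of_succ_le fun n => ideal_succ_free_subset i n

theorem mem_ideal_free_succ {i n : ℕ} {e : E} :
    e ∈ (ideal I c i (n + 1)).free ↔ e ∈ (ideal I c i n).free ∧
      ∀ S ∈ c.F (i + 1) (n + 1), IsLarge I c (i + 1) (ideal I c i n) S → e ∉ I.A S := by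
  rw [ideal_succ, idealStep, mem_addSets_free]
  simp

theorem mem_ideal_cover_succ {i n : ℕ} {S : ι} :
    S ∈ (ideal I c i (n + 1)).cover ↔ S ∈ (ideal I c i n).cover ∨
      S ∈ c.F (i + 1) (n + 1) ∧ IsLarge I c (i + 1) (ideal I c i n) S := by
  rw [ideal_succ, idealStep, State.addSets]
  simp

theorem disjoint_ideal_free_of_added {i n m : ℕ} {S : ι} (hS : S ∈ c.F (i + 1) (n + 1))
    (hl : IsLarge I c (i + 1) (ideal I c i n) S) (hm : n < m) :
    Disjoint (I.A S) (ideal I c i m).free := by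
  refine Disjoint.mono_right (ideal_free_antitone i (Nat.succ_le_of_lt hm)) ?_
  rw [Finset.disjoint_left]
  intro e he h
  exact (mem_ideal_free_succ.1 h).2 S hS hl he

/-- Samples matter only for sets in the sampled families. This is why, once `S` is dropped from the
families of a stage, its sample in that stage is irrelevant. -/
theorem idealStage_congr {i : ℕ} {st : State ι E} {n : ℕ}
    (hF : ∀ k, k < n → c.F i (k + 1) = c'.F i (k + 1))
    (hB : ∀ k, k < n → ∀ S ∈ c.F i (k + 1), c.B i S = c'.B i S) :
    idealStage I c i st n = idealStage I c' i st n := by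
  induction n with
  | zero => rfl
  | succ n ih =>
    have ih := ih (fun k hk => hF k (by omega)) fun k hk => hB k (by omega)
    simp only [idealStage, idealStep]
    rw [ih]
    congr 1
    ext S
    simp only [Finset.mem_filter, ← hF n (Nat.lt_succ_self n)]
    refine and_congr_right fun hS => IsLarge.congr ?_
    rw [hB n (Nat.lt_succ_self n) S hS]

theorem idealStart_congr {i : ℕ}
    (hF : ∀ j, j < i → ∀ k, c.F (j + 1) (k + 1) = c'.F (j + 1) (k + 1))
    (hB : ∀ j, j < i → ∀ S, c.B (j + 1) S = c'.B (j + 1) S) :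
    idealStart I c i = idealStart I c' i := by
  induction i with
  | zero => rfl
  | succ i ih =>
    simp only [idealStart]
    rw [ih (fun j hj => hF j (by omega)) fun j hj => hB j (by omega)]
    exact idealStage_congr (fun k _ => hF i (by omega) k) fun k _ S _ => hB i (by omega) S

/-- The choices where the set `S` is never sampled in stage `i`. -/
def Choices.drop (c : Choices ι E) (i : ℕ) (S : ι) : Choices ι E :=
  ⟨c.B, fun i' k => if i' = i then (c.F i' k).erase S else c.F i' k⟩

theorem Choices.drop_F_self (c : Choices ι E) (i k : ℕ) (S : ι) :
    (c.drop i S).F i k = (c.F i k).erase S := if_pos rfl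

/-- As long as the set `S` is not added, it does not influence the process. -/
theorem ideal_drop {i n : ℕ} {S : ι}
    (h : ∀ m < n, S ∈ c.F (i + 1) (m + 1) → ¬ IsLarge I c (i + 1) (ideal I c i m) S) :
    ideal I (c.drop (i + 1) S) i n = ideal I c i n := by
  induction n with
  | zero =>
    refine idealStart_congr (fun j hj k => ?_) fun j hj S => rfl
    simp only [Choices.drop]
    rw [if_neg (by omega)]
  | succ n ih =>
    have ih := ih fun m hm => h m (by omega)
    rw [ideal_succ, ideal_succ, ih, idealStep, idealStep]
    congr 1
    ext T
    have : IsLarge I (c.drop (i + 1) S) (i + 1) (ideal I c i n) T ↔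
      IsLarge I c (i + 1) (ideal I c i n) T := Iff.rfl
    simp only [Finset.mem_filter]
    rw [this, Choices.drop_F_self, Finset.mem_erase]
    constructor
    · rintro ⟨⟨_, h1⟩, h2⟩
      exact ⟨h1, h2⟩
    · rintro ⟨h1, h2⟩
      exact ⟨⟨fun h3 => h n (Nat.lt_succ_self n) (h3 ▸ h1) (h3 ▸ h2), h1⟩, h2⟩

/-- If some elements of `S` are still free, then the set `S` did not influence the stage so far. -/
theorem ideal_drop_of_not_disjoint {i n : ℕ} {S : ι}
    (h : ¬ Disjoint (I.A S) (ideal I c i n).free) :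
    ideal I (c.drop (i + 1) S) i n = ideal I c i n :=
  -- Had `S` been added earlier in the stage, all its elements would be covered.
  ideal_drop fun _ hm hS hl => h (disjoint_ideal_free_of_added hS hl hm)

/-- In the idealised process, an element is free if and only if it is not covered. -/
theorem mem_ideal_free_iff {i n : ℕ} {e : E} :
    e ∈ (ideal I c i n).free ↔ ∀ S ∈ (ideal I c i n).cover, e ∉ I.A S := by
  have hstage : ∀ i, (e ∈ (ideal I c i 0).free ↔ ∀ S ∈ (ideal I c i 0).cover, e ∉ I.A S) →
      ∀ n, (e ∈ (ideal I c i n).free ↔ ∀ S ∈ (ideal I c i n).cover, e ∉ I.A S) := by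
    intro i h0 n
    induction n with
    | zero => exact h0
    | succ n ih =>
      rw [mem_ideal_free_succ, ih]
      simp only [mem_ideal_cover_succ]
      constructor
      · rintro ⟨h1, h2⟩ S (hS | ⟨hS, hl⟩)
        · exact h1 S hS
        · exact h2 S hS hl
      · intro h
        exact ⟨fun S hS => h S (Or.inl hS), fun S hS hl => h S (Or.inr ⟨hS, hl⟩)⟩
  have h0 : ∀ i, (e ∈ (ideal I c i 0).free ↔ ∀ S ∈ (ideal I c i 0).cover, e ∉ I.A S) := by
    intro i
    induction i with
    | zero => simp [ideal, idealStage, idealStart]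
    | succ i ih =>
      rw [← ideal_iterations]
      exact hstage i ih _
  exact hstage i (h0 i) n

/-! ### Dependence on the random bits -/

/-- The bits determining the family `S_{i,k}`. -/
def familyCoin {i k : ℕ} (hi : i ∈ Finset.Icc 1 I.stages) (hk : k ∈ Finset.Icc 1 I.iterations) :
    ι → Coin I :=
  fun S => .inr (⟨i, hi⟩, ⟨k, hk⟩, S)

/-- The bits determining the subset `B_i(S)`. -/
def sampleCoin {i : ℕ} (hi : i ∈ Finset.Icc 1 I.stages) (S : ι) : E → Coin I :=
  fun e => .inl (⟨i, hi⟩, S, e)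

theorem familyCoin_injective {i k : ℕ} (hi : i ∈ Finset.Icc 1 I.stages)
    (hk : k ∈ Finset.Icc 1 I.iterations) : Function.Injective (familyCoin (I := I) hi hk) := by
  intro S T h
  simpa [familyCoin] using h

theorem sampleCoin_injective {i : ℕ} (hi : i ∈ Finset.Icc 1 I.stages) (S : ι) :
    Function.Injective (sampleCoin (I := I) hi S) := by
  intro S T h
  simpa [sampleCoin] using h

theorem mem_choices_F {i k : ℕ} (hi : i ∈ Finset.Icc 1 I.stages)
    (hk : k ∈ Finset.Icc 1 I.iterations) {ω : Coin I → Bool} {S : ι} :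
    S ∈ (choices I ω).F i k ↔ ω (familyCoin hi hk S) = true := by
  simp only [choices, Finset.mem_filter, Finset.mem_univ, true_and, familyCoin]
  exact ⟨fun ⟨_, _, h⟩ => h, fun h => ⟨hi, hk, h⟩⟩

theorem mem_choices_B {i : ℕ} (hi : i ∈ Finset.Icc 1 I.stages) {ω : Coin I → Bool} {S : ι}
    {e : E} : e ∈ (choices I ω).B i S ↔ e ∈ I.A S ∧ ω (sampleCoin hi S e) = true := by
  simp only [choices, Finset.mem_filter, sampleCoin]
  exact and_congr_right fun _ => ⟨fun ⟨_, h⟩ => h, fun h => ⟨hi, h⟩⟩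

theorem choices_proper (ω : Coin I → Bool) : (choices I ω).Proper I :=
  fun _ _ => Finset.filter_subset _ _

theorem indepOf_familyCoin_B {i k : ℕ} (hi : i ∈ Finset.Icc 1 I.stages)
    (hk : k ∈ Finset.Icc 1 I.iterations) :
    IndepOf (familyCoin (I := I) hi hk) fun ω => (choices I ω).B := by
  intro ω ω' h
  funext j S
  ext e
  simp only [choices, Finset.mem_filter]
  refine and_congr_right fun _ => exists_congr fun hj => ?_
  rw [h _ (by simp [familyCoin])]

theorem indepOf_familyCoin_F {i k : ℕ} (hi : i ∈ Finset.Icc 1 I.stages)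
    (hk : k ∈ Finset.Icc 1 I.iterations) {i' k' : ℕ} (hne : i' ≠ i ∨ k' ≠ k) :
    IndepOf (familyCoin (I := I) hi hk) fun ω => (choices I ω).F i' k' := by
  intro ω ω' h
  ext S
  simp only [choices, Finset.mem_filter, Finset.mem_univ, true_and]
  refine exists_congr fun hj => exists_congr fun hj' => ?_
  rw [h]
  simp only [familyCoin, Set.mem_range, Sum.inr.injEq, Prod.mk.injEq, Subtype.mk.injEq,
    exists_eq_right_right]
  rintro ⟨rfl, rfl⟩
  simp at hne

theorem indepOf_sampleCoin_F {i : ℕ} (hi : i ∈ Finset.Icc 1 I.stages) (S : ι) :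
    IndepOf (sampleCoin (I := I) hi S) fun ω => (choices I ω).F := by
  intro ω ω' h
  funext j k
  ext T
  simp only [choices, Finset.mem_filter, Finset.mem_univ, true_and]
  refine exists_congr fun hj => exists_congr fun hj' => ?_
  rw [h _ (by simp [sampleCoin])]

theorem indepOf_sampleCoin_B {i : ℕ} (hi : i ∈ Finset.Icc 1 I.stages) (S : ι) {i' : ℕ} {S' : ι}
    (hne : i' ≠ i ∨ S' ≠ S) :
    IndepOf (sampleCoin (I := I) hi S) fun ω => (choices I ω).B i' S' := by
  intro ω ω' h
  ext e
  simp only [choices, Finset.mem_filter]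
  refine and_congr_right fun _ => exists_congr fun hj => ?_
  rw [h]
  simp only [sampleCoin, Set.mem_range, Sum.inl.injEq, Prod.mk.injEq, Subtype.mk.injEq, not_exists]
  rintro _ ⟨rfl, rfl, _⟩
  simp at hne

/-- The state before iteration `k` does not depend on the choice of the family `S_{i,k}`. -/
theorem indepOf_familyCoin_ideal {i k n : ℕ} (hi : i + 1 ∈ Finset.Icc 1 I.stages)
    (hk : k ∈ Finset.Icc 1 I.iterations) (hn : n < k) :
    IndepOf (familyCoin (I := I) hi hk) fun ω => ideal I (choices I ω) i n := by
  intro ω ω' h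
  have hB := indepOf_familyCoin_B hi hk ω ω' h
  have hF := fun {i' k'} (hne : i' ≠ i + 1 ∨ k' ≠ k) =>
    indepOf_familyCoin_F hi hk hne ω ω' h
  simp only at hB hF
  simp only [ideal]
  rw [idealStart_congr (c' := choices I ω') (fun j hj k => hF (by omega)) fun j hj S => by rw [hB]]
  exact idealStage_congr (fun k hk => hF (by omega)) fun k hk S _ => by rw [hB]

/-- The state before stage `i + 1` does not depend on the choice of the subset `B_{i+1}(S)`. -/
theorem indepOf_sampleCoin_idealStart {i : ℕ} (hi : i + 1 ∈ Finset.Icc 1 I.stages) (S : ι) :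
    IndepOf (sampleCoin (I := I) hi S) fun ω => ideal I (choices I ω) i 0 := by
  intro ω ω' h
  have hF := indepOf_sampleCoin_F hi S ω ω' h
  have hB := fun {i' S'} (hne : i' ≠ i + 1 ∨ S' ≠ S) =>
    indepOf_sampleCoin_B hi S hne ω ω' h
  simp only at hB hF
  exact idealStart_congr (fun j hj k => by rw [hF]) fun j hj S => hB (by omega)

/-- Without the set `S`, the process in stage `i + 1` does not depend on the choice of the subset
`B_{i+1}(S)`. -/
theorem indepOf_sampleCoin_drop {i n : ℕ} (hi : i + 1 ∈ Finset.Icc 1 I.stages) (S : ι) :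
    IndepOf (sampleCoin (I := I) hi S) fun ω => ideal I ((choices I ω).drop (i + 1) S) i n := by
  intro ω ω' h
  have hF := indepOf_sampleCoin_F hi S ω ω' h
  have hB := fun {i' S'} (hne : i' ≠ i + 1 ∨ S' ≠ S) =>
    indepOf_sampleCoin_B hi S hne ω ω' h
  simp only at hB hF
  simp only [ideal]
  rw [idealStart_congr (c := (choices I ω).drop (i + 1) S) (c' := (choices I ω').drop (i + 1) S)
    (fun j hj k => by simp only [Choices.drop, hF]) fun j hj S => hB (by omega)]
  refine idealStage_congr (fun k hk => by simp only [Choices.drop, hF]) fun k hk T hT => ?_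
  simp only [Choices.drop, if_true, Finset.mem_erase] at hT
  exact hB (Or.inr hT.1)

end Dynamics

/-! ### Concentration of the estimates in the idealised process. -/

section IdealProcess

variable {ι E : Type*} [Fintype ι] [LinearOrder ι] [Fintype E] [DecidableEq E]
variable {I : Input ι E}

/-- A bound for the failure probability of a single estimate. -/
noncomputable def failProb (I : Input ι E) : ℝ := Real.exp (-(I.Λ ^ 5 / 2))

theorem failProb_nonneg : 0 ≤ failProb I := (Real.exp_pos _).le

/-- Either sampling is exact, or the count threshold in `isLarge_iff` is exactly $\Lambda^5$, the
scale of the tail bounds below. -/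
theorem sampleProb_eq_one_or (hI : Regular I) (i : ℕ) :
    I.sampleProb i = 1 ∨ (I.s : ℝ) / 2 ^ i * I.sampleProb i = I.Λ ^ 5 := by
  have := hI.s_pos
  rcases min_choice (1 : ℝ) (I.Λ ^ 5 * (2 ^ i / I.s)) with h | h
  · exact Or.inl h
  · right
    rw [Input.sampleProb, h]
    field_simp

theorem scale_mul_sampleProb_le (hI : Regular I) (i : ℕ) :
    (I.s : ℝ) / 2 ^ i * I.sampleProb i ≤ I.Λ ^ 5 := by
  have := hI.s_pos
  calc (I.s : ℝ) / 2 ^ i * I.sampleProb i ≤ I.s / 2 ^ i * (I.Λ ^ 5 * (2 ^ i / I.s)) := by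
        gcongr
        exact min_le_right _ _
    _ = I.Λ ^ 5 := by field_simp

theorem sample_inter_eq {i : ℕ} (hi : i ∈ Finset.Icc 1 I.stages) (S : ι) (U : Finset E)
    (ω : Coin I → Bool) :
    (choices I ω).B i S ∩ U = {e ∈ I.A S ∩ U | ω (sampleCoin hi S e) = true} := by
  ext e
  simp only [Finset.mem_inter, mem_choices_B hi, Finset.mem_filter]
  tauto

theorem Pr_bit_false {κ : Type*} [Fintype κ] [DecidableEq κ] {p : κ → ℝ} {c : κ} (h : p c = 1) :
    Pr p (fun ω => ω c = false) = 0 := by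
  have := Ex_mul_bit (p := p) (h := fun _ => 1) c (fun _ _ => rfl)
    (fun b => if b = false then 1 else 0)
  simp only [one_mul, h] at this
  simp only [Pr]
  convert this using 1
  · simp [Ex]
  · simp

/-- It is unlikely that a set with few free elements looks large. -/
theorem Pr_large_of_few_free_le (hI : Regular I) {i : ℕ} (hi : i + 1 ∈ Finset.Icc 1 I.stages)
    (n : ℕ) (S : ι) :
    Pr (coinProb I) (fun ω => IsLarge I (choices I ω) (i + 1) (ideal I (choices I ω) i n) S ∧
      4 * ((I.A S ∩ (ideal I (choices I ω) i n).free).card : ℝ) < I.s / 2 ^ (i + 1)) ≤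
      failProb I := by
  rcases sampleProb_eq_one_or hI (i + 1) with h1 | h1
  · refine (Pr_eq_zero fun ω => ?_).trans_le failProb_nonneg
    rintro ⟨hl, hf⟩
    rw [isLarge_iff hI, h1, mul_one] at hl
    have : (((choices I ω).B (i + 1) S ∩ (ideal I (choices I ω) i n).free).card : ℝ) ≤
        (I.A S ∩ (ideal I (choices I ω) i n).free).card := by
      exact_mod_cast Finset.card_le_card
        (Finset.inter_subset_inter_right (choices_proper ω (i + 1) S))
    have h0 : (0 : ℝ) ≤ (I.A S ∩ (ideal I (choices I ω) i n).free).card := Nat.cast_nonneg _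
    linarith
  -- The free part of `S` is computed in the process without `S`, so it is independent of the
  -- sample. It has fewer than $\frac14 s/2^{i+1}$ elements, so twice the mean is below
  -- $\Lambda^5/2$, whereas largeness asks for $\Lambda^5$.
  · have hN : IndepOf (sampleCoin (I := I) hi S) fun ω =>
        I.A S ∩ (ideal I ((choices I ω).drop (i + 1) S) i n).free :=
      (indepOf_sampleCoin_drop hi S).comp fun st => I.A S ∩ st.free
    have key := Ex_upper_tail (p := coinProb I) hI.coinProb_mem (sampleCoin_injective hi S)
      (hI.sampleProb_pos (i + 1)).le (fun _ => rfl)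
      (hN.comp fun U => 4 * (U.card : ℝ) < I.s / 2 ^ (i + 1)) hN
      (a := I.Λ ^ 5) (b := I.Λ ^ 5 / 2) (fun ω hω => by
        have := mul_lt_mul_of_pos_right hω (hI.sampleProb_pos (i + 1))
        rw [h1] at this
        linarith)
    refine le_trans (Pr_mono hI.coinProb_mem fun ω => ?_)
      (key.trans (Real.exp_le_exp.2 (by linarith)))
    rintro ⟨hl, hf⟩
    rw [ideal_drop_of_not_disjoint (hl.not_disjoint hI (choices_proper ω))]
    refine ⟨hf, ?_⟩
    rw [isLarge_iff hI, h1, sample_inter_eq hi] at hl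
    exact hl

theorem iterations_pos (hI : Regular I) : 0 < I.iterations :=
  Nat.clog_pos (by norm_num) hI.two_le_t

theorem familyProb_iterations (hI : Regular I) : I.familyProb I.iterations = 1 := by
  refine min_eq_left ?_
  rw [one_le_div hI.t_pos]
  exact_mod_cast Nat.le_pow_clog (by norm_num) I.t

/-- It is unlikely that a set has many free elements at the beginning of a stage. -/
theorem Pr_many_free_le (hI : Regular I) {i : ℕ} (hi : i ≤ I.stages) (S : ι) :
    Pr (coinProb I) (fun ω => 4 * ((I.s : ℝ) / 2 ^ i) <
      ((I.A S ∩ (ideal I (choices I ω) i 0).free).card : ℝ)) ≤ failProb I := by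
  rcases i with _ | i
  · refine (Pr_eq_zero fun ω => ?_).trans_le failProb_nonneg
    have h1 : ((I.A S ∩ (ideal I (choices I ω) 0 0).free).card : ℝ) ≤ I.s := by
      exact_mod_cast (Finset.card_le_card Finset.inter_subset_left).trans (hI.card_le S)
    have := hI.s_pos
    simp only [pow_zero, div_one, not_lt]
    linarith
  replace hi : i + 1 ∈ Finset.Icc 1 I.stages := Finset.mem_Icc.2 ⟨by omega, hi⟩
  obtain ⟨L, hL⟩ := Nat.exists_eq_add_one.2 (iterations_pos hI)
  have hk : I.iterations ∈ Finset.Icc 1 I.iterations :=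
    Finset.mem_Icc.2 ⟨iterations_pos hI, le_rfl⟩
  have hσ : (0 : ℝ) < I.s / 2 ^ (i + 1) := by
    have := hI.s_pos
    positivity
  set V : (Coin I → Bool) → Finset E := fun ω => (ideal I (choices I ω) i L).free with hV
  -- The last iteration samples every set almost surely, so a set that keeps many free elements must
  -- have failed the largeness test just before it.
  have hmain : ∀ ω, 4 * ((I.s : ℝ) / 2 ^ (i + 1)) <
      ((I.A S ∩ (ideal I (choices I ω) (i + 1) 0).free).card : ℝ) →
      ω (familyCoin hi hk S) = false ∨
        (4 * ((I.s : ℝ) / 2 ^ (i + 1)) < ((I.A S ∩ V ω).card : ℝ) ∧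
          ¬ IsLarge I (choices I ω) (i + 1) (ideal I (choices I ω) i L) S) := by
    intro ω hω
    rw [← ideal_iterations, hL] at hω
    by_cases hc : ω (familyCoin hi hk S) = true
    · right
      refine ⟨hω.trans_le ?_, fun hl => ?_⟩
      · exact_mod_cast Finset.card_le_card
          (Finset.inter_subset_inter_left (ideal_succ_free_subset i L))
      · have hS : S ∈ (choices I ω).F (i + 1) (L + 1) := by
          rw [← hL, mem_choices_F hi hk]; exact hc
        have := disjoint_ideal_free_of_added hS hl (Nat.lt_succ_self L)
        rw [Finset.disjoint_iff_inter_eq_empty.1 this] at hω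
        simp only [Finset.card_empty, Nat.cast_zero] at hω
        linarith
    · exact Or.inl (by simpa using hc)
  refine (Pr_mono hI.coinProb_mem hmain).trans ((Pr_or_le hI.coinProb_mem _ _).trans ?_)
  rw [Pr_bit_false (show coinProb I (familyCoin hi hk S) = 1 from familyProb_iterations hI),
    zero_add]
  have hnd : ∀ ω, 4 * ((I.s : ℝ) / 2 ^ (i + 1)) < ((I.A S ∩ V ω).card : ℝ) →
      ¬ Disjoint (I.A S) (ideal I (choices I ω) i L).free := by
    intro ω h hd
    simp only [hV] at h
    rw [Finset.disjoint_iff_inter_eq_empty.1 hd] at h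
    simp only [Finset.card_empty, Nat.cast_zero] at h
    linarith
  rcases sampleProb_eq_one_or hI (i + 1) with h1 | h1
  · refine le_trans (Pr_mono hI.coinProb_mem
      (Q := fun ω => ∃ e ∈ I.A S, ω (sampleCoin hi S e) = false) fun ω => ?_) ?_
    · rintro ⟨h2, h3⟩
      by_contra! h
      apply h3
      have : (choices I ω).B (i + 1) S = I.A S := by
        ext e
        rw [mem_choices_B hi]
        exact ⟨fun h => h.1, fun he => ⟨he, by simpa using h e he⟩⟩
      rw [isLarge_iff hI, h1, mul_one, this]
      simp only [hV] at h2
      linarith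
    · refine (Pr_exists_le hI.coinProb_mem _ _).trans ?_
      rw [Finset.sum_eq_zero fun e _ => Pr_bit_false (c := sampleCoin hi S e) h1]
      exact failProb_nonneg
  · have hN : IndepOf (sampleCoin (I := I) hi S) fun ω =>
        I.A S ∩ (ideal I ((choices I ω).drop (i + 1) S) i L).free :=
      (indepOf_sampleCoin_drop hi S).comp fun st => I.A S ∩ st.free
    -- The mean exceeds $4\Lambda^5$; the lower tail bound uses half of it, hence $b=2\Lambda^5$.
    have key := Ex_lower_tail (p := coinProb I) hI.coinProb_mem (sampleCoin_injective hi S)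
      (hI.sampleProb_pos (i + 1)).le (min_le_left _ _) (fun _ => rfl)
      (hN.comp fun U => 4 * ((I.s : ℝ) / 2 ^ (i + 1)) < (U.card : ℝ)) hN
      (a := I.Λ ^ 5) (b := 2 * I.Λ ^ 5) (fun ω hω => by
        have := mul_lt_mul_of_pos_right hω (hI.sampleProb_pos (i + 1))
        rw [mul_assoc, h1] at this
        linarith)
    refine le_trans (Pr_mono hI.coinProb_mem fun ω => ?_)
      (key.trans (Real.exp_le_exp.2 ?_))
    · rintro ⟨h2, h3⟩
      rw [ideal_drop_of_not_disjoint (hnd ω h2)]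
      refine ⟨h2, ?_⟩
      rw [isLarge_iff hI, h1, sample_inter_eq hi, not_le] at h3
      exact h3.le
    · have := pow_pos hI.Λ_pos 5
      linarith

/-- It is unlikely that a set is added at the beginning of a stage. -/
theorem Pr_cut_le (hI : Regular I) (hΛ : 2 ≤ I.Λ) {i : ℕ} (hi : i + 1 ∈ Finset.Icc 1 I.stages)
    (S : ι) :
    Pr (coinProb I) (fun ω => I.Λ ^ 10 ≤
      (((choices I ω).B (i + 1) S ∩ (ideal I (choices I ω) i 0).free).card : ℝ)) ≤
      2 * failProb I := by
  have hN : IndepOf (sampleCoin (I := I) hi S) fun ω =>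
      I.A S ∩ (ideal I (choices I ω) i 0).free :=
    (indepOf_sampleCoin_idealStart hi S).comp fun st => I.A S ∩ st.free
  have key := Ex_upper_tail (p := coinProb I) hI.coinProb_mem (sampleCoin_injective hi S)
    (hI.sampleProb_pos (i + 1)).le (fun _ => rfl)
    (hN.comp fun U => (U.card : ℝ) ≤ 4 * (I.s / 2 ^ i)) hN
    -- Here $16=2\cdot4\cdot2$: twice the mean, at most $4s/2^i$ free elements, and $s/2^i=2\cdot
    -- s/2^{i+1}$ because the sampling rate is that of stage $i+1$.
    (a := I.Λ ^ 10) (b := 16 * I.Λ ^ 5) (fun ω hω => by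
      have h1 := mul_le_mul_of_nonneg_right hω (hI.sampleProb_pos (i + 1)).le
      have h2 := scale_mul_sampleProb_le hI (i + 1)
      have h3 : (I.s : ℝ) / 2 ^ i = 2 * (I.s / 2 ^ (i + 1)) := by
        rw [pow_succ]; field_simp
      rw [h3] at h1
      linarith)
  have h5 : (32 : ℝ) ≤ I.Λ ^ 5 := by
    calc (32 : ℝ) = 2 ^ 5 := by norm_num
      _ ≤ I.Λ ^ 5 := by gcongr
  calc _ ≤ Pr (coinProb I) (fun ω => 4 * ((I.s : ℝ) / 2 ^ i) <
          ((I.A S ∩ (ideal I (choices I ω) i 0).free).card : ℝ) ∨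
          (((I.A S ∩ (ideal I (choices I ω) i 0).free).card : ℝ) ≤ 4 * (I.s / 2 ^ i) ∧
          I.Λ ^ 10 ≤ (({e ∈ I.A S ∩ (ideal I (choices I ω) i 0).free |
            ω (sampleCoin hi S e) = true} : Finset E).card : ℝ))) := by
        refine Pr_mono hI.coinProb_mem fun ω hω => ?_
        rw [sample_inter_eq hi] at hω
        rcases lt_or_ge (4 * ((I.s : ℝ) / 2 ^ i))
          ((I.A S ∩ (ideal I (choices I ω) i 0).free).card : ℝ) with h | h
        · exact Or.inl h
        · exact Or.inr ⟨h, hω⟩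
    _ ≤ failProb I + Real.exp (16 * I.Λ ^ 5 - I.Λ ^ 10) :=
        (Pr_or_le hI.coinProb_mem _ _).trans (add_le_add
          (Pr_many_free_le hI ((Nat.le_succ i).trans (Finset.mem_Icc.1 hi).2) S) key)
    _ ≤ failProb I + failProb I := by
        gcongr
        refine Real.exp_le_exp.2 ?_
        have : I.Λ ^ 10 = I.Λ ^ 5 * I.Λ ^ 5 := by ring
        nlinarith
    _ = 2 * failProb I := by ring

open scoped Classical in
/-- The sets that contain `e` and are large after `n` iterations of stage `i + 1`. -/
noncomputable def largeSets (I : Input ι E) (c : Choices ι E) (i n : ℕ) (e : E) : Finset ι :=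
  {S | IsLarge I c (i + 1) (ideal I c i n) S ∧ e ∈ I.A S}

theorem mem_largeSets {c : Choices ι E} {i n : ℕ} {e : E} {S : ι} :
    S ∈ largeSets I c i n e ↔ IsLarge I c (i + 1) (ideal I c i n) S ∧ e ∈ I.A S := by
  simp [largeSets]

theorem card_largeSets_le (hI : Regular I) (c : Choices ι E) (i n : ℕ) (e : E) :
    (largeSets I c i n e).card ≤ I.t := by
  refine (Finset.card_le_card fun S hS => ?_).trans (hI.degree_le e)
  simpa using (mem_largeSets.1 hS).2

theorem largeSets_succ_subset (hI : Regular I) (c : Choices ι E) (i n : ℕ) (e : E) :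
    largeSets I c i (n + 1) e ⊆ largeSets I c i n e := fun S hS => by
  rw [mem_largeSets] at hS ⊢
  exact ⟨hS.1.mono hI (ideal_succ_free_subset i n), hS.2⟩

theorem indepOf_familyCoin_largeSets {i k n : ℕ} (hi : i + 1 ∈ Finset.Icc 1 I.stages)
    (hk : k ∈ Finset.Icc 1 I.iterations) (hn : n < k) (e : E) :
    IndepOf (familyCoin (I := I) hi hk) fun ω => largeSets I (choices I ω) i n e := by
  intro ω ω' h
  have h1 := indepOf_familyCoin_ideal hi hk hn ω ω' h
  have h2 := indepOf_familyCoin_B hi hk ω ω' h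
  simp only at h1 h2
  ext S
  rw [mem_largeSets, mem_largeSets]
  refine and_congr_left fun _ => IsLarge.congr ?_
  rw [h1, h2]

theorem mem_ideal_free_succ_iff {i n : ℕ} (hi : i + 1 ∈ Finset.Icc 1 I.stages)
    (hk : n + 1 ∈ Finset.Icc 1 I.iterations) {ω : Coin I → Bool} {e : E} :
    e ∈ (ideal I (choices I ω) i (n + 1)).free ↔ e ∈ (ideal I (choices I ω) i n).free ∧
      ∀ S ∈ largeSets I (choices I ω) i n e, ω (familyCoin hi hk S) = false := by
  rw [mem_ideal_free_succ]
  refine and_congr_right fun _ => forall_congr' fun S => ?_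
  rw [mem_choices_F hi hk, mem_largeSets]
  constructor
  · rintro h ⟨h1, h2⟩
    by_contra h3
    exact h (by simpa using h3) h1 h2
  · intro h h1 h2 h3
    rw [h ⟨h2, h3⟩] at h1
    exact absurd h1 (by simp)

theorem familyProb_le (k : ℕ) : I.familyProb k ≤ 2 ^ k / I.t := min_le_right _ _

/-- At most $\Lambda^5t/2^n$ sets sampled at rate at most $2^k/t$ have mean at most $2\Lambda^5
2^m$, far below the threshold $\Lambda^{10}2^m$. The family for iteration $k>n$ has not yet
influenced the idealised process, so it is fresh. -/
theorem Pr_many_sampled_le (hI : Regular I) (hΛ : 2 ≤ I.Λ) {i n k m : ℕ}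
    (hi : i + 1 ∈ Finset.Icc 1 I.stages) (hk : k ∈ Finset.Icc 1 I.iterations)
    (hm : k = n + 1 + m) (e : E) {thr : ℝ} (hthr : I.Λ ^ 10 * 2 ^ m ≤ thr) :
    Pr (coinProb I) (fun ω => (largeSets I (choices I ω) i n e).card ≤ I.Λ ^ 5 * I.t / 2 ^ n ∧
      thr ≤ ({S ∈ largeSets I (choices I ω) i n e | ω (familyCoin hi hk S) = true}.card : ℝ)) ≤
      failProb I := by
  have ht := hI.t_pos
  have hN := indepOf_familyCoin_largeSets hi hk (show n < k by omega) e
  refine (Ex_upper_tail (p := coinProb I) hI.coinProb_mem (familyCoin_injective hi hk)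
    (hI.familyProb_pos k).le (fun _ => rfl)
    (hN.comp fun U => (U.card : ℝ) ≤ I.Λ ^ 5 * I.t / 2 ^ n) hN
    (a := thr) (b := 4 * I.Λ ^ 5 * 2 ^ m) (fun ω hω => ?_)).trans (Real.exp_le_exp.2 ?_)
  · calc 2 * I.familyProb k * ((largeSets I (choices I ω) i n e).card : ℝ) ≤
        2 * (2 ^ k / I.t) * (I.Λ ^ 5 * I.t / 2 ^ n) := by
          gcongr
          exact familyProb_le k
      _ = 4 * I.Λ ^ 5 * 2 ^ m := by
          rw [hm, pow_add, pow_succ]; field_simp; ring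
  · have h5 : (32 : ℝ) ≤ I.Λ ^ 5 := by
      calc (32 : ℝ) = 2 ^ 5 := by norm_num
        _ ≤ I.Λ ^ 5 := by gcongr
    have h10 : I.Λ ^ 10 = I.Λ ^ 5 * I.Λ ^ 5 := by ring
    have h2 : (1 : ℝ) ≤ 2 ^ m := one_le_pow₀ (by norm_num)
    have h3 : I.Λ ^ 5 ≤ I.Λ ^ 10 - 4 * I.Λ ^ 5 := by nlinarith
    have h4 : I.Λ ^ 5 * 1 ≤ (I.Λ ^ 10 - 4 * I.Λ ^ 5) * 2 ^ m := by
      gcongr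
      linarith
    nlinarith

/-- When the sampling rate is $q=2^{n+1}/t$, more than $\Lambda^5/q$ sets are all missed with
probability at most $(1-q)^d\le e^{-qd}\le e^{-\Lambda^5}$; when the rate is truncated to $1$, they
cannot be missed. -/
theorem Pr_survive_le (hI : Regular I) {i n : ℕ}
    (hi : i + 1 ∈ Finset.Icc 1 I.stages) (hk : n + 1 ∈ Finset.Icc 1 I.iterations) (e : E) :
    Pr (coinProb I) (fun ω => I.Λ ^ 5 * I.t / 2 ^ (n + 1) <
        (largeSets I (choices I ω) i n e).card ∧
      ∀ S ∈ largeSets I (choices I ω) i n e, ω (familyCoin hi hk S) = false) ≤ failProb I := by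
  classical
  have ht := hI.t_pos
  have hΛ := hI.Λ_pos
  have hN := indepOf_familyCoin_largeSets hi hk (Nat.lt_succ_self n) e
  have h1 := Ex_mul_no_success (p := coinProb I) (familyCoin_injective hi hk)
    (q := I.familyProb (n + 1)) (fun _ => rfl)
    (hN.comp fun U => if I.Λ ^ 5 * I.t / 2 ^ (n + 1) < U.card then (1 : ℝ) else 0) hN
  refine (Pr_le_Ex hI.coinProb_mem (fun ω hω => ?_) fun ω => ?_).trans (h1.trans_le ?_)
  · rw [if_pos hω.1, if_pos hω.2, one_mul]
  · positivity
  · rw [← Ex_const (p := coinProb I) (failProb I)]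
    refine Ex_mono hI.coinProb_mem fun ω => ?_
    split_ifs with h
    · rw [one_mul]
      set d := (largeSets I (choices I ω) i n e).card
      have hd : 0 < d := by
        have : (0 : ℝ) < d := lt_of_le_of_lt (by positivity) h
        exact_mod_cast this
      rcases min_choice (1 : ℝ) (2 ^ (n + 1) / I.t) with hq | hq
      · rw [Input.familyProb, hq, sub_self, zero_pow hd.ne']
        exact failProb_nonneg
      · have hq' : I.familyProb (n + 1) = 2 ^ (n + 1) / I.t := hq
        have hq1 : I.familyProb (n + 1) ≤ 1 := min_le_left _ _
        calc (1 - I.familyProb (n + 1)) ^ d ≤ Real.exp (-I.familyProb (n + 1)) ^ d := by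
              refine pow_le_pow_left₀ (by linarith) ?_ _
              linarith [Real.add_one_le_exp (-I.familyProb (n + 1))]
          _ = Real.exp (-(d * I.familyProb (n + 1))) := by
              rw [← Real.exp_nat_mul]; congr 1; ring
          _ ≤ failProb I := by
              refine Real.exp_le_exp.2 (neg_le_neg ?_)
              have h2 : I.Λ ^ 5 * I.t / 2 ^ (n + 1) * (2 ^ (n + 1) / I.t) = I.Λ ^ 5 := by
                field_simp
              have h3 := mul_le_mul_of_nonneg_right h.le (hI.familyProb_pos (n + 1)).le
              rw [hq', h2] at h3
              rw [hq']
              have := pow_pos hΛ 5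
              linarith
    · rw [zero_mul]; exact failProb_nonneg

/-- It is unlikely that an element is contained in many large sampled sets. -/
theorem Pr_pretend_le (hI : Regular I) (hΛ : 2 ≤ I.Λ) {i n k m : ℕ}
    (hi : i + 1 ∈ Finset.Icc 1 I.stages) (hk : k ∈ Finset.Icc 1 I.iterations)
    (hm : k = n + 1 + m) (e : E) {thr : ℝ} (hthr : I.Λ ^ 10 * 2 ^ m ≤ thr) :
    Pr (coinProb I) (fun ω => e ∈ (ideal I (choices I ω) i n).free ∧
      thr ≤ ({S ∈ largeSets I (choices I ω) i n e | ω (familyCoin hi hk S) = true}.card : ℝ)) ≤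
      2 * failProb I := by
  have ht := hI.t_pos
  have hp := hI.coinProb_mem
  have h0 := failProb_nonneg (I := I)
  have hmany := Pr_many_sampled_le hI hΛ hi hk hm e hthr
  -- Before the first iteration the degree bound $t$ already limits the number of large sets. Later,
  -- too many large sets now means too many before the previous iteration, which the element would
  -- have had to survive.
  rcases n with _ | n
  · refine (Pr_mono hp fun ω hω => ?_).trans (hmany.trans (by linarith))
    refine ⟨?_, hω.2⟩
    have h1 : ((largeSets I (choices I ω) i 0 e).card : ℝ) ≤ I.t := by
      exact_mod_cast card_largeSets_le hI _ _ _ _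
    have h2 : (1 : ℝ) ≤ I.Λ ^ 5 := one_le_pow₀ hI.one_le
    rw [pow_zero, div_one]
    nlinarith
  · have hk' : n + 1 ∈ Finset.Icc 1 I.iterations := by
      rw [Finset.mem_Icc] at hk ⊢; omega
    have hsurv := Pr_survive_le hI hi hk' e
    refine (Pr_mono hp fun ω hω => ?_).trans
      ((Pr_or_le hp _ _).trans ((add_le_add hmany hsurv).trans_eq (two_mul _).symm))
    rcases le_or_gt ((largeSets I (choices I ω) i (n + 1) e).card : ℝ)
      (I.Λ ^ 5 * I.t / 2 ^ (n + 1)) with h | h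
    · exact Or.inl ⟨h, hω.2⟩
    · refine Or.inr ⟨h.trans_le ?_, ((mem_ideal_free_succ_iff hi hk').1 hω.1).2⟩
      exact_mod_cast Finset.card_le_card (largeSets_succ_subset hI _ _ _ _)

end IdealProcess

/-! ### The expected size of the idealised cover. -/

section IdealSize

variable {ι E : Type*} [Fintype ι] [LinearOrder ι] [Fintype E] [DecidableEq E]
variable {I : Input ι E}

open scoped Classical in
/-- The expected number of sets containing `e` that are added in iteration `n + 1` of stage `i + 1`
while `e` is free. -/
noncomputable def load (I : Input ι E) (i n : ℕ) (e : E) : ℝ :=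
  Ex (coinProb I) fun ω => (if e ∈ (ideal I (choices I ω) i n).free then 1 else 0) *
    ({S ∈ largeSets I (choices I ω) i n e | S ∈ (choices I ω).F (i + 1) (n + 1)}.card : ℝ)

/-- The probability that `e` is free after `n` iterations of stage `i + 1`. -/
noncomputable def freeProb (I : Input ι E) (i n : ℕ) (e : E) : ℝ :=
  Pr (coinProb I) fun ω => e ∈ (ideal I (choices I ω) i n).free

theorem load_eq {i n : ℕ} (hi : i + 1 ∈ Finset.Icc 1 I.stages)
    (hk : n + 1 ∈ Finset.Icc 1 I.iterations) (e : E) :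
    load I i n e = Ex (coinProb I) fun ω =>
      (if e ∈ (ideal I (choices I ω) i n).free then 1 else 0) *
        (I.familyProb (n + 1) * ((largeSets I (choices I ω) i n e).card : ℝ)) := by
  classical
  have h1 := (indepOf_familyCoin_ideal hi hk (Nat.lt_succ_self n)).comp
    fun st => if e ∈ st.free then (1 : ℝ) else 0
  have h2 := indepOf_familyCoin_largeSets hi hk (Nat.lt_succ_self n) e
  rw [← Ex_mul_successes (p := coinProb I) (q := I.familyProb (n + 1)) (fun _ => rfl) h1 h2, load]
  refine Ex_congr fun ω => ?_
  simp only [mem_choices_F hi hk]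

theorem load_zero_le (hI : Regular I) {i : ℕ} (hi : i + 1 ∈ Finset.Icc 1 I.stages)
    (hk : 0 + 1 ∈ Finset.Icc 1 I.iterations) (e : E) :
    load I i 0 e ≤ 2 * freeProb I i 0 e := by
  have ht := hI.t_pos
  rw [load_eq hi hk, freeProb, Pr_eq_Ex, ← Ex_const_mul]
  refine Ex_mono hI.coinProb_mem fun ω => ?_
  split_ifs
  · have h1 : ((largeSets I (choices I ω) i 0 e).card : ℝ) ≤ I.t := by
      exact_mod_cast card_largeSets_le hI _ _ _ _
    calc 1 * (I.familyProb (0 + 1) * ((largeSets I (choices I ω) i 0 e).card : ℝ)) ≤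
        1 * (2 ^ (0 + 1) / I.t * I.t) := by
          gcongr
          exact familyProb_le _
      _ = 2 * 1 := by field_simp; norm_num
  · simp

theorem familyProb_succ_le (hI : Regular I) (k : ℕ) :
    I.familyProb (k + 1) ≤ 2 * I.familyProb k := by
  have ht := hI.t_pos
  rcases min_choice (1 : ℝ) (2 ^ k / I.t) with h | h
  · have h1 : I.familyProb k = 1 := h
    have h2 : I.familyProb (k + 1) ≤ 1 := min_le_left _ _
    linarith
  · have h1 : I.familyProb k = 2 ^ k / I.t := h
    rw [h1]
    refine (familyProb_le _).trans_eq ?_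
    rw [pow_succ]; ring

/-- Bernoulli gives $1+qd\le(1+q)^d$, and $(1+q)^d(1-q)^d\le1$. Read probabilistically: mean number
of hits times probability of no hit is at most the probability of a hit. -/
theorem mul_one_sub_pow_le {q : ℝ} (h0 : 0 ≤ q) (h1 : q ≤ 1) (d : ℕ) :
    q * d * (1 - q) ^ d ≤ 1 - (1 - q) ^ d := by
  have h2 : (0 : ℝ) ≤ (1 - q) ^ d := pow_nonneg (by linarith) d
  have h3 : 1 + (d : ℝ) * q ≤ (1 + q) ^ d := one_add_mul_le_pow (by linarith) d
  have h4 : (1 + q) ^ d * (1 - q) ^ d ≤ 1 := by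
    rw [← mul_pow]
    exact pow_le_one₀ (by nlinarith) (by nlinarith)
  nlinarith

/-- To be hit in the next iteration an element must first survive this one. The rate at most doubles
and the large sets only shrink, so the load is at most $2\,\mathbb E[\mathbf
1_{\mathrm{free}}\,qd(1-q)^d]$, which `mul_one_sub_pow_le` turns into the drop of `freeProb`. -/
theorem load_succ_le (hI : Regular I) {i n : ℕ} (hi : i + 1 ∈ Finset.Icc 1 I.stages)
    (hk : n + 1 + 1 ∈ Finset.Icc 1 I.iterations) (e : E) :
    load I i (n + 1) e ≤ 2 * (freeProb I i n e - freeProb I i (n + 1) e) := by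
  classical
  have hp := hI.coinProb_mem
  have hk' : n + 1 ∈ Finset.Icc 1 I.iterations := by
    rw [Finset.mem_Icc] at hk ⊢; omega
  set q := I.familyProb (n + 1) with hq
  have hq0 : 0 ≤ q := (hI.familyProb_pos _).le
  have hq1 : q ≤ 1 := min_le_left _ _
  have h1 := (indepOf_familyCoin_ideal hi hk' (Nat.lt_succ_self n)).comp
    fun st => if e ∈ st.free then (1 : ℝ) else 0
  have h2 := indepOf_familyCoin_largeSets hi hk' (Nat.lt_succ_self n) e
  have h12 : IndepOf (familyCoin (I := I) hi hk') fun ω =>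
      (if e ∈ (ideal I (choices I ω) i n).free then (1 : ℝ) else 0) *
        (q * (largeSets I (choices I ω) i n e).card) := fun ω ω' h => by
    have a := h1 ω ω' h
    have b := h2 ω ω' h
    simp only at a b ⊢
    rw [a, b]
  have key1 := Ex_mul_no_success (p := coinProb I) (familyCoin_injective hi hk') (q := q)
    (fun _ => rfl) h12 h2
  have key2 := Ex_mul_no_success (p := coinProb I) (familyCoin_injective hi hk') (q := q)
    (fun _ => rfl) h1 h2
  have hfree : freeProb I i (n + 1) e = Ex (coinProb I) fun ω =>
      (if e ∈ (ideal I (choices I ω) i n).free then (1 : ℝ) else 0) *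
        (1 - q) ^ (largeSets I (choices I ω) i n e).card := by
    rw [← key2, freeProb, Pr_eq_Ex]
    refine Ex_congr fun ω => ?_
    by_cases h6 : e ∈ (ideal I (choices I ω) i n).free <;>
    by_cases h7 : ∀ S ∈ largeSets I (choices I ω) i n e, ω (familyCoin hi hk' S) = false <;>
    simp [h6, h7, mem_ideal_free_succ_iff hi hk']
  calc load I i (n + 1) e
      ≤ Ex (coinProb I) fun ω => 2 * (((if e ∈ (ideal I (choices I ω) i n).free then 1 else 0) *
          (q * (largeSets I (choices I ω) i n e).card)) *
          if ∀ S ∈ largeSets I (choices I ω) i n e, ω (familyCoin hi hk' S) = false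
            then 1 else 0) := by
        rw [load_eq hi hk]
        refine Ex_mono hp fun ω => ?_
        simp only [mem_ideal_free_succ_iff hi hk']
        have h3 : I.familyProb (n + 1 + 1) ≤ 2 * q := familyProb_succ_le hI _
        have h4 : ((largeSets I (choices I ω) i (n + 1) e).card : ℝ) ≤
            (largeSets I (choices I ω) i n e).card := by
          exact_mod_cast Finset.card_le_card (largeSets_succ_subset hI _ _ _ _)
        have h5 : I.familyProb (n + 1 + 1) * ((largeSets I (choices I ω) i (n + 1) e).card : ℝ) ≤
            2 * q * (largeSets I (choices I ω) i n e).card :=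
          mul_le_mul h3 h4 (Nat.cast_nonneg _) (by linarith)
        by_cases h6 : e ∈ (ideal I (choices I ω) i n).free <;>
        by_cases h7 : ∀ S ∈ largeSets I (choices I ω) i n e, ω (familyCoin hi hk' S) = false
        · simp only [h6, true_and, if_true, if_pos h7]
          linarith
        all_goals simp [h6, h7]
    _ = 2 * Ex (coinProb I) fun ω => ((if e ∈ (ideal I (choices I ω) i n).free then 1 else 0) *
          (q * (largeSets I (choices I ω) i n e).card)) *
          (1 - q) ^ (largeSets I (choices I ω) i n e).card := by
        rw [Ex_const_mul]
        congr 1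
        refine Eq.trans (Ex_congr fun ω => ?_) key1
        congr
    _ ≤ 2 * (freeProb I i n e - freeProb I i (n + 1) e) := by
        rw [hfree, freeProb, Pr_eq_Ex, ← Ex_sub]
        refine mul_le_mul_of_nonneg_left (Ex_mono hp fun ω => ?_) (by norm_num)
        have := mul_one_sub_pow_le hq0 hq1 (largeSets I (choices I ω) i n e).card
        split_ifs
        · simpa using this
        · simp

/-- When a free element is covered, the expected number of sets covering it is constant. -/
theorem sum_load_le (hI : Regular I) {i : ℕ} (hi : i + 1 ∈ Finset.Icc 1 I.stages) (e : E) :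
    ∑ n ∈ Finset.range I.iterations, load I i n e ≤ 4 * freeProb I i 0 e := by
  -- The subtracted term makes the induction telescope; the first iteration contributes $2=4-2$
  -- times the initial free probability.
  have key : ∀ m, m + 1 ≤ I.iterations → ∑ n ∈ Finset.range (m + 1), load I i n e ≤
      4 * freeProb I i 0 e - 2 * freeProb I i m e := by
    intro m
    induction m with
    | zero =>
      intro h
      rw [Finset.sum_range_one]
      linarith [load_zero_le hI hi (Finset.mem_Icc.2 ⟨le_rfl, h⟩) e]
    | succ m ih =>
      intro h
      rw [Finset.sum_range_succ]
      linarith [load_succ_le hI hi (Finset.mem_Icc.2 ⟨by omega, h⟩) e, ih (by omega)]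
  obtain ⟨L, hL⟩ := Nat.exists_eq_add_one.2 (iterations_pos hI)
  rw [hL]
  have h1 := key L hL.ge
  have h2 : 0 ≤ freeProb I i L e := Pr_nonneg hI.coinProb_mem _
  linarith

/-- Weak duality: weighting each element by its fractional coverage, which is at least one, and
exchanging the sums. -/
theorem sum_le_sum_mul_of_fractional {A : ι → Finset E} {x : ι → ℝ} (hx : IsFractionalCover A x)
    (f : E → ℝ) (hf : ∀ e, 0 ≤ f e) :
    ∑ e, f e ≤ ∑ S, x S * ∑ e ∈ A S, f e := by
  calc ∑ e, f e ≤ ∑ e, f e * ∑ S with e ∈ A S, x S :=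
        Finset.sum_le_sum fun e _ => le_mul_of_one_le_right (hf e) (hx.2 e)
    _ = ∑ e, ∑ S, if e ∈ A S then x S * f e else 0 := by
        refine Finset.sum_congr rfl fun e _ => ?_
        rw [Finset.mul_sum, Finset.sum_filter]
        exact Finset.sum_congr rfl fun S _ => by split_ifs <;> ring
    _ = ∑ S, x S * ∑ e ∈ A S, f e := by
        rw [Finset.sum_comm]
        refine Finset.sum_congr rfl fun S _ => ?_
        rw [Finset.mul_sum, ← Finset.sum_filter]
        simp

theorem sum_freeProb_le (hI : Regular I) {x : ι → ℝ} (hx : IsFractionalCover I.A x) {i : ℕ}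
    (hi : i ≤ I.stages) :
    ∑ e, freeProb I i 0 e ≤ (4 * (I.s / 2 ^ i) + I.s * failProb I) * ∑ S, x S := by
  classical
  have hp := hI.coinProb_mem
  refine (sum_le_sum_mul_of_fractional hx _ fun e => Pr_nonneg hp _).trans ?_
  rw [Finset.mul_sum]
  refine Finset.sum_le_sum fun S _ => ?_
  rw [mul_comm]
  refine mul_le_mul_of_nonneg_right ?_ (hx.1 S)
  have hs := hI.s_pos
  simp only [Pr_eq_Ex]
  rw [← Ex_sum]
  calc _ ≤ Ex (coinProb I) fun ω => 4 * ((I.s : ℝ) / 2 ^ i) + I.s *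
        (if 4 * ((I.s : ℝ) / 2 ^ i) < ((I.A S ∩ (ideal I (choices I ω) i 0).free).card : ℝ)
          then 1 else 0) := by
        refine Ex_mono hp fun ω => ?_
        have h1 : (∑ e ∈ I.A S, if e ∈ (ideal I (choices I ω) i 0).free then (1 : ℝ) else 0) =
            ((I.A S ∩ (ideal I (choices I ω) i 0).free).card : ℝ) := by
          rw [Finset.sum_boole, Finset.filter_mem_eq_inter]
        rw [h1]
        split_ifs with h
        · have h2 : ((I.A S ∩ (ideal I (choices I ω) i 0).free).card : ℝ) ≤ I.s := by
            exact_mod_cast (Finset.card_le_card Finset.inter_subset_left).trans (hI.card_le S)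
          have : (0 : ℝ) ≤ 4 * ((I.s : ℝ) / 2 ^ i) := by positivity
          linarith
        · linarith
    _ ≤ _ := by
        rw [Ex_add, Ex_const, Ex_const_mul]
        have := Pr_many_free_le hI hi S
        rw [Pr_eq_Ex] at this
        gcongr

/-- The nonempty sets. -/
def nonemptySets (I : Input ι E) : Finset ι := {S | (I.A S).Nonempty}

theorem sum_card_le (hI : Regular I) :
    ∑ S, ((I.A S).card : ℝ) ≤ I.t * Fintype.card E := by
  have h1 : ∑ S, (I.A S).card = ∑ e, elemDegree I.A Finset.univ e := by
    simp only [elemDegree, Finset.card_filter]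
    rw [Finset.sum_comm]
    refine Finset.sum_congr rfl fun S _ => ?_
    rw [Finset.card_eq_sum_ones, ← Finset.sum_filter]
    simp
  have h2 : ∑ e, elemDegree I.A Finset.univ e ≤ Fintype.card E * I.t := by
    refine (Finset.sum_le_card_nsmul _ _ _ fun e _ => hI.degree_le e).trans_eq ?_
    simp
  rw [← h1] at h2
  rw [mul_comm]
  exact_mod_cast h2

/-- The number of indices is not controlled by $s$, $t$ and $|E|$, since sets may be empty; failure
probabilities are therefore summed only over nonempty sets. -/
theorem card_nonemptySets_le (hI : Regular I) :
    ((nonemptySets I).card : ℝ) ≤ I.t * Fintype.card E := by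
  refine le_trans ?_ (sum_card_le hI)
  rw [Finset.card_eq_sum_ones, Nat.cast_sum, nonemptySets, Finset.sum_filter]
  refine Finset.sum_le_sum fun S _ => ?_
  split_ifs with h
  · exact_mod_cast Finset.card_pos.2 h
  · positivity

theorem card_le_mul_sum (hI : Regular I) {x : ι → ℝ} (hx : IsFractionalCover I.A x) :
    (Fintype.card E : ℝ) ≤ I.s * ∑ S, x S := by
  have h := sum_le_sum_mul_of_fractional hx (fun _ => 1) fun _ => zero_le_one
  simp only [Finset.sum_const, Finset.card_univ, nsmul_eq_mul, mul_one] at h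
  refine h.trans ?_
  rw [Finset.mul_sum]
  refine Finset.sum_le_sum fun S _ => ?_
  rw [mul_comm]
  exact mul_le_mul_of_nonneg_right (by exact_mod_cast hI.card_le S) (hx.1 S)

open scoped Classical in
/-- The sets added in iteration `n + 1` of stage `i + 1` of the idealised process. -/
noncomputable def addedSets (I : Input ι E) (c : Choices ι E) (i n : ℕ) : Finset ι :=
  {S ∈ c.F (i + 1) (n + 1) | IsLarge I c (i + 1) (ideal I c i n) S}

theorem card_ideal_cover_le (c : Choices ι E) (m : ℕ) :
    (ideal I c m 0).cover.card ≤
      ∑ i ∈ Finset.range m, ∑ n ∈ Finset.range I.iterations, (addedSets I c i n).card := by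
  induction m with
  | zero => simp [ideal, idealStage, idealStart]
  | succ m ih =>
    rw [Finset.sum_range_succ, ← ideal_iterations]
    have key : ∀ l, (ideal I c m l).cover.card ≤ (ideal I c m 0).cover.card +
        ∑ n ∈ Finset.range l, (addedSets I c m n).card := by
      intro l
      induction l with
      | zero => simp
      | succ l ihl =>
        rw [Finset.sum_range_succ, ← add_assoc]
        exact (Finset.card_union_le _ _).trans (Nat.add_le_add_right ihl _)
    exact (key _).trans (Nat.add_le_add_right ih _)

-- Charging: an added set either looks large despite having few free elements, or it has at least
-- $\frac14 s/2^{i+1}$ free elements, each of which pays $4\cdot2^{i+1}/s$ for it.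
open scoped Classical in
theorem card_addedSets_le (hI : Regular I) {c : Choices ι E} (hc : c.Proper I) (i n : ℕ) :
    ((addedSets I c i n).card : ℝ) ≤
      (∑ S ∈ nonemptySets I, if IsLarge I c (i + 1) (ideal I c i n) S ∧
        4 * ((I.A S ∩ (ideal I c i n).free).card : ℝ) < I.s / 2 ^ (i + 1) then 1 else 0) +
      4 * (2 ^ (i + 1) / I.s) * ∑ e, (if e ∈ (ideal I c i n).free then 1 else 0) *
        ({S ∈ largeSets I c i n e | S ∈ c.F (i + 1) (n + 1)}.card : ℝ) := by
  have hs := hI.s_pos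
  set X := addedSets I c i n with hX
  set U := (ideal I c i n).free with hU
  have hXl : ∀ S ∈ X, IsLarge I c (i + 1) (ideal I c i n) S :=
    fun S hS => (Finset.mem_filter.1 hS).2
  have hXn : X ⊆ nonemptySets I := fun S hS => by
    simp only [nonemptySets, Finset.mem_filter, Finset.mem_univ, true_and]
    exact ((hXl S hS).nonempty hI).mono (Finset.inter_subset_left.trans (hc _ _))
  have h1 : (∑ e, (if e ∈ U then (1 : ℝ) else 0) * ({S ∈ largeSets I c i n e |
      S ∈ c.F (i + 1) (n + 1)}.card : ℝ)) = ∑ S ∈ X, ((I.A S ∩ U).card : ℝ) := by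
    have h2 : ∀ e, ({S ∈ largeSets I c i n e | S ∈ c.F (i + 1) (n + 1)}.card : ℝ) =
        ∑ S ∈ X, if e ∈ I.A S then 1 else 0 := by
      intro e
      rw [Finset.sum_boole]
      congr 2
      ext S
      simp only [Finset.mem_filter, mem_largeSets, hX, addedSets]
      tauto
    simp only [h2, Finset.mul_sum]
    rw [Finset.sum_comm]
    refine Finset.sum_congr rfl fun S _ => ?_
    have h3 : I.A S ∩ U = {e ∈ (Finset.univ : Finset E) | e ∈ U ∧ e ∈ I.A S} := by
      ext e; simp [and_comm]
    rw [h3, Finset.card_filter, Nat.cast_sum]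
    refine Finset.sum_congr rfl fun e _ => ?_
    by_cases h4 : e ∈ U <;> by_cases h5 : e ∈ I.A S <;> simp [h4, h5]
  rw [h1, Finset.card_eq_sum_ones, Nat.cast_sum, Finset.mul_sum]
  calc _ ≤ ∑ S ∈ X, ((if IsLarge I c (i + 1) (ideal I c i n) S ∧
        4 * ((I.A S ∩ U).card : ℝ) < I.s / 2 ^ (i + 1) then 1 else 0) +
        4 * (2 ^ (i + 1) / (I.s : ℝ)) * ((I.A S ∩ U).card : ℝ)) := by
        refine Finset.sum_le_sum fun S hS => ?_
        split_ifs with h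
        · have : (0 : ℝ) ≤ 4 * (2 ^ (i + 1) / (I.s : ℝ)) * ((I.A S ∩ U).card : ℝ) := by positivity
          rw [Nat.cast_one]
          linarith
        · rw [Nat.cast_one, zero_add]
          simp only [not_and, not_lt] at h
          have h3 := mul_le_mul_of_nonneg_left (h (hXl S hS))
            (show (0 : ℝ) ≤ 2 ^ (i + 1) / I.s by positivity)
          have h4 : (2 ^ (i + 1) / (I.s : ℝ)) * (I.s / 2 ^ (i + 1)) = 1 := by field_simp
          rw [h4] at h3
          linarith
    _ ≤ _ := by
        rw [Finset.sum_add_distrib]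
        refine add_le_add_left ?_ _
        exact Finset.sum_le_sum_of_subset_of_nonneg hXn fun S _ _ => by split_ifs <;> simp

theorem Ex_card_addedSets_le (hI : Regular I) {i : ℕ} (hi : i + 1 ∈ Finset.Icc 1 I.stages)
    (n : ℕ) :
    Ex (coinProb I) (fun ω => ((addedSets I (choices I ω) i n).card : ℝ)) ≤
      I.t * Fintype.card E * failProb I + 4 * (2 ^ (i + 1) / I.s) * ∑ e, load I i n e := by
  refine (Ex_mono hI.coinProb_mem fun ω =>
    card_addedSets_le hI (choices_proper ω) i n).trans ?_
  rw [Ex_add, Ex_const_mul, Ex_sum, Ex_sum]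
  refine add_le_add ?_ (le_of_eq ?_)
  · refine (Finset.sum_le_card_nsmul _ _ (failProb I) fun S _ => ?_).trans ?_
    · have := Pr_large_of_few_free_le hI hi n S
      rw [Pr] at this
      refine le_trans (le_of_eq (Ex_congr fun ω => ?_)) this
      congr
    rw [nsmul_eq_mul]
    exact mul_le_mul_of_nonneg_right (card_nonemptySets_le hI) failProb_nonneg
  · simp only [load]

/-- The expected size of the cover computed by the idealised process. -/
theorem Ex_card_ideal_cover_le (hI : Regular I) {x : ι → ℝ} (hx : IsFractionalCover I.A x) :
    Ex (coinProb I) (fun ω => ((ideal I (choices I ω) I.stages 0).cover.card : ℝ)) ≤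
      I.stages * (I.iterations * (I.t * Fintype.card E * failProb I) +
        (128 + 16 * 2 ^ I.stages * failProb I) * ∑ S, x S) := by
  have hp := hI.coinProb_mem
  have hs := hI.s_pos
  have hX : 0 ≤ ∑ S, x S := Finset.sum_nonneg fun S _ => hx.1 S
  have hδ := failProb_nonneg (I := I)
  calc _ ≤ Ex (coinProb I) (fun ω => ∑ i ∈ Finset.range I.stages,
        ∑ n ∈ Finset.range I.iterations, ((addedSets I (choices I ω) i n).card : ℝ)) :=
        Ex_mono hp fun ω => by exact_mod_cast card_ideal_cover_le (choices I ω) I.stages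
    _ = ∑ i ∈ Finset.range I.stages, ∑ n ∈ Finset.range I.iterations,
        Ex (coinProb I) (fun ω => ((addedSets I (choices I ω) i n).card : ℝ)) := by
        rw [Ex_sum]
        exact Finset.sum_congr rfl fun i _ => Ex_sum _ _
    _ ≤ ∑ i ∈ Finset.range I.stages, (I.iterations * (I.t * Fintype.card E * failProb I) +
        (128 + 16 * 2 ^ I.stages * failProb I) * ∑ S, x S) := by
        refine Finset.sum_le_sum fun i hi => ?_
        rw [Finset.mem_range] at hi
        have hi' : i + 1 ∈ Finset.Icc 1 I.stages := Finset.mem_Icc.2 ⟨by omega, hi⟩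
        refine (Finset.sum_le_sum fun n _ => Ex_card_addedSets_le hI hi' n).trans ?_
        rw [Finset.sum_add_distrib, Finset.sum_const, Finset.card_range, nsmul_eq_mul,
          ← Finset.mul_sum, Finset.sum_comm]
        gcongr ?_ + ?_
        · exact le_rfl
        calc 4 * (2 ^ (i + 1) / (I.s : ℝ)) *
              ∑ e, ∑ n ∈ Finset.range I.iterations, load I i n e
            ≤ 4 * (2 ^ (i + 1) / (I.s : ℝ)) * (4 * ((4 * (I.s / 2 ^ i) + I.s * failProb I) *
              ∑ S, x S)) := by
              gcongr
              refine (Finset.sum_le_sum fun e _ => sum_load_le hI hi' e).trans ?_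
              rw [← Finset.mul_sum]
              have := sum_freeProb_le hI hx hi.le
              gcongr
          -- $128=4\cdot4\cdot4\cdot2$: the charge, the load constant, the bound on free elements,
          -- and $2^{i+1}/2^i$.
          _ = (128 + 16 * 2 ^ (i + 1) * failProb I) * ∑ S, x S := by
              rw [pow_succ]; field_simp; ring
          _ ≤ _ := by
              gcongr
              · norm_num
              · exact hi
    _ = _ := by
        rw [Finset.sum_const, Finset.card_range, nsmul_eq_mul]

end IdealSize

section Invariants

variable {ι E : Type*} [Fintype ι] [LinearOrder ι] [Fintype E] [DecidableEq E]
variable {I : Input ι E} {c : Choices ι E}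

/-! ### Deterministic invariants of the algorithm -/

/-- The sets of the cover are nonempty and have no free elements. -/
def State.Clean (I : Input ι E) (st : State ι E) : Prop :=
  ∀ S ∈ st.cover, (I.A S).Nonempty ∧ Disjoint (I.A S) st.free

theorem State.Clean.addSets {st : State ι E} (h : st.Clean I) {X : Finset ι}
    (hX : ∀ S ∈ X, (I.A S).Nonempty) : (st.addSets I.A X).Clean I := by
  intro S hS
  rcases Finset.mem_union.1 hS with hS | hS
  · exact ⟨(h S hS).1, (h S hS).2.mono_right Finset.sdiff_subset⟩
  · refine ⟨hX S hS, Finset.disjoint_left.2 fun e he hf => ?_⟩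
    exact (mem_addSets_free.1 hf).2 S hS he

theorem State.Clean.pretend {st : State ι E} (h : st.Clean I) (Y : Finset E) :
    (st.pretend Y).Clean I :=
  fun S hS => ⟨(h S hS).1, (h S hS).2.mono_right Finset.sdiff_subset⟩

theorem IsLarge.set_nonempty (hI : Regular I) (hc : c.Proper I) {i : ℕ} {st : State ι E} {S : ι}
    (h : IsLarge I c i st S) : (I.A S).Nonempty :=
  (h.nonempty hI).mono (Finset.inter_subset_left.trans (hc _ _))

/-- `G k` consists of sets of `S_{i,k}`, among them all those that are currently large. -/
def Tracks (I : Input ι E) (c : Choices ι E) (i : ℕ) (G : ℕ → Finset ι) (st : State ι E)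
    (k₀ R : ℕ) : Prop :=
  ∀ k, k₀ ≤ k → k < k₀ + R → G k ⊆ c.F i k ∧ ∀ S ∈ c.F i k, IsLarge I c i st S → S ∈ G k

theorem Tracks.mono (hI : Regular I) {i : ℕ} {G : ℕ → Finset ι} {st st' : State ι E}
    {k₀ R k₀' R' : ℕ} (h : Tracks I c i G st k₀ R) (hst : st'.free ⊆ st.free) (hk : k₀ ≤ k₀')
    (hR : k₀' + R' ≤ k₀ + R) : Tracks I c i G st' k₀' R' := fun k h1 h2 =>
  have := h k (by omega) (by omega)
  ⟨this.1, fun S hS hl => this.2 S hS (hl.mono hI hst)⟩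

theorem sparsifyStep_free_subset {i : ℕ} {thr : ℕ → ℝ} {x : (ℕ → Finset ι) × State ι E} {k : ℕ} :
    (sparsifyStep I c i thr x k).2.free ⊆ x.2.free := Finset.sdiff_subset

/-- Filtering by largeness loses nothing: free sets only shrink, so a set that is not large now
never becomes large later in the stage. -/
theorem Tracks.sparsifyStep (hI : Regular I) {i : ℕ} {thr : ℕ → ℝ}
    {x : (ℕ → Finset ι) × State ι E} {k k₀ R : ℕ} (h : Tracks I c i x.1 x.2 k₀ R) :
    Tracks I c i (sparsifyStep I c i thr x k).1 (sparsifyStep I c i thr x k).2 k₀ R := by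
  intro k' h1 h2
  obtain ⟨h3, h4⟩ := h k' h1 h2
  have hl := fun S (h : IsLarge I c i (RepeatedSparsification.sparsifyStep I c i thr x k).2 S) =>
    h.mono hI sparsifyStep_free_subset
  by_cases hk : k' = k
  · subst hk
    simp only [RepeatedSparsification.sparsifyStep, Function.update_self] at hl ⊢
    refine ⟨fun S hS => ?_, fun S hS hS' => ?_⟩
    · simp only [Finset.mem_filter] at hS
      exact h3 hS.1
    simp only [Finset.mem_filter]
    exact ⟨h4 S hS (hl S hS'), hl S hS'⟩
  · simp only [RepeatedSparsification.sparsifyStep, Function.update_of_ne hk] at hl ⊢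
    exact ⟨h3, fun S hS hS' => h4 S hS (hl S hS')⟩

theorem sparsify_succ (i : ℕ) (thr : ℕ → ℝ) (k₀ n : ℕ) (G : ℕ → Finset ι) (st : State ι E) :
    sparsify I c i thr k₀ (n + 1) G st =
      sparsifyStep I c i thr (sparsify I c i thr k₀ n G st) (k₀ + n) := by
  rw [sparsify, List.range'_1_concat, List.foldl_append]
  rfl

theorem Tracks.sparsify (hI : Regular I) {i : ℕ} {thr : ℕ → ℝ} {k₁ : ℕ}
    {G : ℕ → Finset ι} {st : State ι E} {k₀ R : ℕ} (h : Tracks I c i G st k₀ R) (n : ℕ) :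
    Tracks I c i (sparsify I c i thr k₁ n G st).1 (sparsify I c i thr k₁ n G st).2 k₀ R := by
  induction n with
  | zero => exact h
  | succ n ih => rw [sparsify_succ]; exact ih.sparsifyStep hI

theorem sparsify_free_subset (i : ℕ) (thr : ℕ → ℝ) (k₀ n : ℕ) (G : ℕ → Finset ι)
    (st : State ι E) : (sparsify I c i thr k₀ n G st).2.free ⊆ st.free := by
  induction n with
  | zero => exact subset_rfl
  | succ n ih => rw [sparsify_succ]; exact sparsifyStep_free_subset.trans ih

theorem State.Clean.sparsify {st : State ι E} (h : st.Clean I) (i : ℕ) (thr : ℕ → ℝ) (k₀ n : ℕ)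
    (G : ℕ → Finset ι) : (sparsify I c i thr k₀ n G st).2.Clean I := by
  induction n with
  | zero => exact h
  | succ n ih => rw [sparsify_succ]; exact ih.pretend _

open scoped Classical in
theorem baseCase_succ (i k₀ n : ℕ) (G : ℕ → Finset ι) (st : State ι E) :
    baseCase I c i k₀ (n + 1) G st = (baseCase I c i k₀ n G st).addSets I.A
      {S ∈ G (k₀ + n) | S ∉ (baseCase I c i k₀ n G st).cover ∧
        IsLarge I c i (baseCase I c i k₀ n G st) S} := by
  rw [baseCase, List.range'_1_concat, List.foldl_append]
  rfl

theorem baseCase_free_subset (i k₀ n : ℕ) (G : ℕ → Finset ι) (st : State ι E) :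
    (baseCase I c i k₀ n G st).free ⊆ st.free := by
  induction n with
  | zero => exact subset_rfl
  | succ n ih => rw [baseCase_succ]; exact Finset.sdiff_subset.trans ih

theorem State.Clean.baseCase (hI : Regular I) (hc : c.Proper I) {st : State ι E}
    (h : st.Clean I) (i k₀ n : ℕ) (G : ℕ → Finset ι) : (baseCase I c i k₀ n G st).Clean I := by
  induction n with
  | zero => exact h
  | succ n ih =>
    rw [baseCase_succ]
    refine ih.addSets fun S hS => ?_
    simp only [Finset.mem_filter] at hS
    exact hS.2.2.set_nonempty hI hc

theorem recSplit_free_subset (i : ℕ) (R : ℕ) : ∀ (k₀ : ℕ) (G : ℕ → Finset ι) (st : State ι E),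
    (recSplit I c i k₀ R G st).free ⊆ st.free := by
  induction R using Nat.strong_induction_on with
  | _ R ih =>
    intro k₀ G st
    rw [recSplit]
    split_ifs with h
    · exact baseCase_free_subset ..
    · rw [not_or, not_le] at h
      exact ((ih (R - R / 2) (by omega) _ _ _).trans (sparsify_free_subset ..)).trans
        (ih (R / 2) (by omega) _ _ _)

theorem State.Clean.recSplit (hI : Regular I) (hc : c.Proper I) (i : ℕ) (R : ℕ) :
    ∀ (k₀ : ℕ) (G : ℕ → Finset ι) (st : State ι E), st.Clean I →
      (recSplit I c i k₀ R G st).Clean I := by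
  induction R using Nat.strong_induction_on with
  | _ R ih =>
    intro k₀ G st hst
    rw [RepeatedSparsification.recSplit]
    split_ifs with h
    · exact hst.baseCase hI hc _ _ _ _
    · rw [not_or, not_le] at h
      exact ih (R - R / 2) (by omega) _ _ _ ((ih (R / 2) (by omega) _ _ _ hst).sparsify _ _ _ _ _)

theorem cut_nonempty (hI : Regular I) (hc : c.Proper I) {i : ℕ} {st : State ι E} {S : ι}
    (h : I.Λ ^ 10 ≤ ((c.B i S ∩ st.free).card : ℝ)) : (I.A S).Nonempty := by
  have h1 := (pow_pos hI.Λ_pos 10).trans_le h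
  rw [Nat.cast_pos, Finset.card_pos] at h1
  exact h1.mono (Finset.inter_subset_left.trans (hc _ _))

theorem State.Clean.cut (hI : Regular I) (hc : c.Proper I) {st : State ι E} (h : st.Clean I)
    (i : ℕ) {X : Finset ι} (hX : ∀ S ∈ X, I.Λ ^ 10 ≤ ((c.B i S ∩ st.free).card : ℝ)) :
    (st.addSets I.A X).Clean I :=
  h.addSets fun S hS => cut_nonempty hI hc (hX S hS)

theorem State.Clean.stage (hI : Regular I) (hc : c.Proper I) {st : State ι E} (h : st.Clean I)
    (i : ℕ) : (stage I c st i).Clean I :=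
  State.Clean.recSplit hI hc _ _ _ _ _
    ((h.cut hI hc i fun _ hS => (Finset.mem_filter.1 hS).2).sparsify _ _ _ _ _)

/-- The state of the algorithm after `n` stages. -/
noncomputable def afterStages (I : Input ι E) (c : Choices ι E) (n : ℕ) : State ι E :=
  (List.range' 1 n).foldl (stage I c) ⟨∅, Finset.univ⟩

theorem afterStages_succ (n : ℕ) :
    afterStages I c (n + 1) = stage I c (afterStages I c n) (n + 1) := by
  rw [afterStages, List.range'_1_concat, List.foldl_append, add_comm 1 n]
  rfl

theorem clean_afterStages (hI : Regular I) (hc : c.Proper I) (n : ℕ) :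
    (afterStages I c n).Clean I := by
  induction n with
  | zero => intro S hS; simp [afterStages] at hS
  | succ n ih => rw [afterStages_succ]; exact ih.stage hI hc _

theorem solution_eq (ω : Coin I → Bool) :
    solution I ω = (afterStages I (choices I ω) I.stages).cover ∪
      cleanUp I.A (afterStages I (choices I ω) I.stages).cover := rfl

theorem solution_subset (hI : Regular I) (ω : Coin I → Bool) :
    solution I ω ⊆ nonemptySets I := by
  intro S hS
  simp only [nonemptySets, Finset.mem_filter, Finset.mem_univ, true_and]
  rw [solution_eq] at hS
  rcases Finset.mem_union.1 hS with hS | hS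
  · exact (clean_afterStages hI (choices_proper ω) _ S hS).1
  · simp only [cleanUp, Finset.mem_filter, Finset.mem_univ, true_and] at hS
    obtain ⟨e, _, he, _⟩ := hS
    exact ⟨e, he⟩

theorem isSetCover_solution (h : ∀ e, ∃ S, e ∈ I.A S) (ω : Coin I → Bool) :
    IsSetCover I.A (solution I ω) := by
  intro e
  rw [solution_eq]
  set X := (afterStages I (choices I ω) I.stages).cover
  by_cases he : ∃ S ∈ X, e ∈ I.A S
  · obtain ⟨S, hS, heS⟩ := he
    exact ⟨S, Finset.mem_union_left _ hS, heS⟩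
  · push Not at he
    obtain ⟨S₀, hS₀⟩ := h e
    obtain ⟨S, hS, hmin⟩ := Finset.exists_min_image {S | e ∈ I.A S} id ⟨S₀, by simpa using hS₀⟩
    simp only [Finset.mem_filter, Finset.mem_univ, true_and, id] at hS hmin
    refine ⟨S, Finset.mem_union_right _ ?_, hS⟩
    simp only [cleanUp, Finset.mem_filter, Finset.mem_univ, true_and]
    exact ⟨e, he, hS, hmin⟩

/-- The order on the indices makes the set chosen for an uncovered element unique. -/
theorem card_cleanUp_le (A : ι → Finset E) (X : Finset ι) :
    (cleanUp A X).card ≤ ({e | ∀ S ∈ X, e ∉ A S} : Finset E).card := by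
  calc (cleanUp A X).card ≤ (Finset.biUnion {e | ∀ S ∈ X, e ∉ A S}
        fun e => {S | e ∈ A S ∧ ∀ S', e ∈ A S' → S ≤ S'}).card := by
        refine Finset.card_le_card fun S hS => ?_
        simp only [cleanUp, Finset.mem_filter, Finset.mem_univ, true_and, Finset.mem_biUnion]
          at hS ⊢
        exact hS
    _ ≤ ({e | ∀ S ∈ X, e ∉ A S} : Finset E).card * 1 := by
        refine Finset.card_biUnion_le_card_mul _ _ _ fun e _ => Finset.card_le_one.2 ?_
        intro S hS T hT
        simp only [Finset.mem_filter, Finset.mem_univ, true_and] at hS hT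
        exact le_antisymm (hS.2 T hT.1) (hT.2 S hS.1)
    _ = _ := mul_one _

end Invariants

section Coupling

variable {ι E : Type*} [Fintype ι] [LinearOrder ι] [Fintype E] [DecidableEq E]
variable {I : Input ι E}

/-! ### Comparison with the idealised process -/

/-- The random state `X` agrees, at every single element and set, with the state of the idealised
process after `n` iterations of stage `i + 1`, up to an error probability `a`. -/
structure Close (I : Input ι E) (i n : ℕ) (X : (Coin I → Bool) → State ι E) (a : ℝ) : Prop where
  free : ∀ e, Pr (coinProb I) (fun ω =>
    ¬ (e ∈ (X ω).free ↔ e ∈ (ideal I (choices I ω) i n).free)) ≤ a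
  cover : ∀ S, Pr (coinProb I) (fun ω =>
    ¬ (S ∈ (X ω).cover ↔ S ∈ (ideal I (choices I ω) i n).cover)) ≤ a

/-- The factor by which the error probability grows in each step. -/
noncomputable def growth (I : Input ι E) : ℝ := 2 + I.t + I.s * I.t

theorem one_le_growth : 1 ≤ growth I := by
  have : (0 : ℝ) ≤ I.t + I.s * I.t := by positivity
  rw [growth]
  linarith

theorem Close.mono {i n : ℕ} {X : (Coin I → Bool) → State ι E} {a b : ℝ} (h : Close I i n X a)
    (hab : a ≤ b) : Close I i n X b :=
  ⟨fun e => (h.free e).trans hab, fun S => (h.cover S).trans hab⟩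

/-- Elements and sets agree after a step if they agree locally before the step and nothing
exceptional happens. -/
theorem Close.step (hI : Regular I) {i n i' n' : ℕ} {X X' : (Coin I → Bool) → State ι E} {a : ℝ}
    (h : Close I i n X a) (ha : 2 * failProb I ≤ a) (f₁ : ι → (Coin I → Bool) → Prop)
    (f₂ : E → (Coin I → Bool) → Prop) (hf₁ : ∀ S, Pr (coinProb I) (f₁ S) ≤ 2 * failProb I)
    (hf₂ : ∀ e, Pr (coinProb I) (f₂ e) ≤ 2 * failProb I)
    (hfree : ∀ ω e, (e ∈ (X ω).free ↔ e ∈ (ideal I (choices I ω) i n).free) →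
      (∀ S, e ∈ I.A S → ¬ f₁ S ω ∧
        ∀ e' ∈ I.A S, (e' ∈ (X ω).free ↔ e' ∈ (ideal I (choices I ω) i n).free)) →
      ¬ f₂ e ω → (e ∈ (X' ω).free ↔ e ∈ (ideal I (choices I ω) i' n').free))
    (hcover : ∀ ω S, (S ∈ (X ω).cover ↔ S ∈ (ideal I (choices I ω) i n).cover) → ¬ f₁ S ω →
      (∀ e' ∈ I.A S, (e' ∈ (X ω).free ↔ e' ∈ (ideal I (choices I ω) i n).free)) →
      (S ∈ (X' ω).cover ↔ S ∈ (ideal I (choices I ω) i' n').cover)) :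
    Close I i' n' X' (growth I * a) := by
  have hp := hI.coinProb_mem
  have ha0 : 0 ≤ a := le_trans (by linarith [failProb_nonneg (I := I)]) ha
  have hset : ∀ S, Pr (coinProb I) (fun ω => ∃ e' ∈ I.A S,
      ¬ (e' ∈ (X ω).free ↔ e' ∈ (ideal I (choices I ω) i n).free)) ≤ I.s * a := fun S =>
    Pr_exists_le_mul hp _ _ (hI.card_le S) ha0 fun e _ => h.free e
  constructor
  · intro e
    -- Local union bound: at most `t` sets contain `e`, each with its own exception and at most `s`
    -- elements. With `e` itself and `f₂ e` this gives the factor $2+t+st$.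
    have h1 : Pr (coinProb I) (fun ω => ∃ S ∈ ({S | e ∈ I.A S} : Finset ι), f₁ S ω ∨
        ∃ e' ∈ I.A S, ¬ (e' ∈ (X ω).free ↔ e' ∈ (ideal I (choices I ω) i n).free)) ≤
        I.t * (a + I.s * a) := by
      refine Pr_exists_le_mul hp _ _ (hI.degree_le e) (by positivity) fun S _ => ?_
      exact (Pr_or_le hp _ _).trans (add_le_add ((hf₁ S).trans ha) (hset S))
    calc _ ≤ Pr (coinProb I) (fun ω =>
          ¬ (e ∈ (X ω).free ↔ e ∈ (ideal I (choices I ω) i n).free) ∨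
          (∃ S ∈ ({S | e ∈ I.A S} : Finset ι), f₁ S ω ∨
          ∃ e' ∈ I.A S, ¬ (e' ∈ (X ω).free ↔ e' ∈ (ideal I (choices I ω) i n).free)) ∨
          f₂ e ω) := by
          refine Pr_mono hp fun ω hω => ?_
          by_contra! hcon
          refine hω (hfree ω e hcon.1 (fun S hS => ?_) hcon.2.2)
          exact hcon.2.1 S (by simpa using hS)
      _ ≤ a + (I.t * (a + I.s * a) + a) :=
          (Pr_or_le hp _ _).trans (add_le_add (h.free e)
            ((Pr_or_le hp _ _).trans (add_le_add h1 ((hf₂ e).trans ha))))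
      _ = growth I * a := by rw [growth]; ring
  · intro S
    calc _ ≤ Pr (coinProb I) (fun ω =>
          ¬ (S ∈ (X ω).cover ↔ S ∈ (ideal I (choices I ω) i n).cover) ∨ f₁ S ω ∨
          ∃ e' ∈ I.A S, ¬ (e' ∈ (X ω).free ↔ e' ∈ (ideal I (choices I ω) i n).free)) := by
          refine Pr_mono hp fun ω hω => ?_
          by_contra! hcon
          exact hω (hcover ω S hcon.1 hcon.2.1 hcon.2.2)
      _ ≤ a + (a + I.s * a) :=
          (Pr_or_le hp _ _).trans (add_le_add (h.cover S)
            ((Pr_or_le hp _ _).trans (add_le_add ((hf₁ S).trans ha) (hset S))))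
      _ ≤ growth I * a := by
          have h1 : (1 : ℝ) ≤ I.t := by
            have := hI.two_le_t
            exact_mod_cast (by omega : 1 ≤ I.t)
          have h2 : (I.s : ℝ) * 1 ≤ I.s * I.t := by gcongr
          have h3 : 2 + (I.s : ℝ) ≤ growth I := by rw [growth]; linarith
          have := mul_le_mul_of_nonneg_right h3 ha0
          linarith

theorem inter_eq_inter_of_agree {A B U V : Finset E} (hB : B ⊆ A)
    (h : ∀ e ∈ A, (e ∈ U ↔ e ∈ V)) : B ∩ U = B ∩ V := by
  ext e
  simp only [Finset.mem_inter]
  exact and_congr_right fun he => h e (hB he)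

/-- The idealised process does not move here. If the states agree on `S`, cutting `S` requires the
same count in the idealised state, the event bounded by `Pr_cut_le`. -/
theorem Close.cut (hI : Regular I) (hΛ : 2 ≤ I.Λ) {i : ℕ} (hi : i + 1 ∈ Finset.Icc 1 I.stages)
    {X : (Coin I → Bool) → State ι E} {a : ℝ} (h : Close I i 0 X a) (ha : 2 * failProb I ≤ a)
    {Y : (Coin I → Bool) → Finset ι} (hY : ∀ ω S, S ∈ Y ω ↔
      I.Λ ^ 10 ≤ (((choices I ω).B (i + 1) S ∩ (X ω).free).card : ℝ)) :
    Close I i 0 (fun ω => (X ω).addSets I.A (Y ω)) (growth I * a) := by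
  refine h.step hI ha (fun S ω => I.Λ ^ 10 ≤
    (((choices I ω).B (i + 1) S ∩ (ideal I (choices I ω) i 0).free).card : ℝ))
    (fun _ _ => False) (Pr_cut_le hI hΛ hi) (fun e => ?_) ?_ ?_
  · rw [Pr_eq_zero fun _ => id]
    linarith [failProb_nonneg (I := I)]
  · intro ω e he hS _
    rw [mem_addSets_free, ← he]
    refine and_iff_left fun S hSY heS => ?_
    obtain ⟨h1, h2⟩ := hS S heS
    rw [hY, inter_eq_inter_of_agree (choices_proper ω _ S) h2] at hSY
    exact h1 hSY
  · intro ω S hS h1 h2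
    rw [← hS]
    simp only [State.addSets, Finset.mem_union]
    refine or_iff_left fun hSY => ?_
    rw [hY, inter_eq_inter_of_agree (choices_proper ω _ S) h2] at hSY
    exact h1 hSY

theorem isLarge_iff_of_agree {ω : Coin I → Bool} {i : ℕ} {st st' : State ι E} {S : ι}
    (h : ∀ e ∈ I.A S, (e ∈ st.free ↔ e ∈ st'.free)) :
    IsLarge I (choices I ω) i st S ↔ IsLarge I (choices I ω) i st' S :=
  IsLarge.congr (inter_eq_inter_of_agree (choices_proper ω _ S) h)

/-- Where the states agree, the sets making an element pretend are large in the idealised state and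
sampled for iteration `k`, so the element would realise the rare event of `Pr_pretend_le`. -/
theorem Close.sparsifyStep (hI : Regular I) (hΛ : 2 ≤ I.Λ) {i n k m : ℕ}
    (hi : i + 1 ∈ Finset.Icc 1 I.stages) (hk : k ∈ Finset.Icc 1 I.iterations)
    (hm : k = n + 1 + m) {thr : ℕ → ℝ} (hthr : I.Λ ^ 10 * 2 ^ m ≤ thr k)
    {x : (Coin I → Bool) → (ℕ → Finset ι) × State ι E} {a : ℝ}
    (h : Close I i n (fun ω => (x ω).2) a) (ha : 2 * failProb I ≤ a)
    (hG : ∀ ω, (x ω).1 k ⊆ (choices I ω).F (i + 1) k) :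
    Close I i n (fun ω => (sparsifyStep I (choices I ω) (i + 1) thr (x ω) k).2)
      (growth I * a) := by
  classical
  refine h.step hI ha (fun _ _ => False) (fun e ω => e ∈ (ideal I (choices I ω) i n).free ∧
      thr k ≤ ({S ∈ largeSets I (choices I ω) i n e | ω (familyCoin hi hk S) = true}.card : ℝ))
    (fun e => ?_) (fun e => Pr_pretend_le hI hΛ hi hk hm e hthr) ?_ fun ω S hS _ _ => hS
  · rw [Pr_eq_zero fun _ => id]
    linarith [failProb_nonneg (I := I)]
  · intro ω e he hS hf
    rw [← he]
    simp only [RepeatedSparsification.sparsifyStep, State.pretend, Finset.mem_sdiff,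
      Finset.mem_filter]
    refine and_iff_left ?_
    rintro ⟨h1, h2⟩
    refine hf ⟨he.1 h1, h2.trans ?_⟩
    rw [elemDegree]
    refine Nat.cast_le.2 (Finset.card_le_card fun S hSG => ?_)
    simp only [Finset.mem_filter, mem_largeSets] at hSG ⊢
    obtain ⟨⟨h3, h4⟩, h5⟩ := hSG
    exact ⟨⟨(isLarge_iff_of_agree (hS S h5).2).1 h4, h5⟩, (mem_choices_F hi hk).1 (hG ω h3)⟩

theorem two_failProb_le_pow_mul {a : ℝ} (ha : 2 * failProb I ≤ a) (m : ℕ) :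
    2 * failProb I ≤ growth I ^ m * a :=
  ha.trans (le_mul_of_one_le_left (le_trans (by linarith [failProb_nonneg (I := I)]) ha)
    (one_le_pow₀ one_le_growth))

theorem Close.sparsify (hI : Regular I) (hΛ : 2 ≤ I.Λ) {i n R : ℕ}
    (hi : i + 1 ∈ Finset.Icc 1 I.stages) (hR : n + R ≤ I.iterations) {thr : ℕ → ℝ}
    (hthr : ∀ m, I.Λ ^ 10 * 2 ^ m ≤ thr (n + 1 + m))
    {G : (Coin I → Bool) → ℕ → Finset ι} {X : (Coin I → Bool) → State ι E} {a : ℝ}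
    (h : Close I i n X a) (ha : 2 * failProb I ≤ a)
    (hG : ∀ ω, Tracks I (choices I ω) (i + 1) (G ω) (X ω) (n + 1) R) {m : ℕ} (hm : m ≤ R) :
    Close I i n (fun ω => (sparsify I (choices I ω) (i + 1) thr (n + 1) m (G ω) (X ω)).2)
      (growth I ^ m * a) := by
  induction m with
  | zero => rw [pow_zero, one_mul]; exact h
  | succ m ih =>
    have ih := ih (by omega)
    rw [pow_succ', mul_assoc]
    simp only [sparsify_succ]
    refine Close.sparsifyStep hI hΛ hi (Finset.mem_Icc.2 ⟨by omega, by omega⟩) rfl (hthr m) ih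
      (two_failProb_le_pow_mul ha m) fun ω => ?_
    exact (((hG ω).sparsify hI m) _ (by omega) (by omega)).1

/-- Each iteration mirrors an idealised one with no exceptional event: by `Tracks` the large sampled
sets coincide, and by `Clean` a set already in the cover is not large, so excluding it changes
nothing. -/
theorem Close.baseCase (hI : Regular I) {i n R : ℕ}
    {G : (Coin I → Bool) → ℕ → Finset ι} {X : (Coin I → Bool) → State ι E} {a : ℝ}
    (h : Close I i n X a) (ha : 2 * failProb I ≤ a) (hX : ∀ ω, (X ω).Clean I)
    (hG : ∀ ω, Tracks I (choices I ω) (i + 1) (G ω) (X ω) (n + 1) R) {m : ℕ} (hm : m ≤ R) :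
    Close I i (n + m) (fun ω => baseCase I (choices I ω) (i + 1) (n + 1) m (G ω) (X ω))
      (growth I ^ m * a) := by
  classical
  induction m with
  | zero => rw [pow_zero, one_mul]; exact h
  | succ m ih =>
    have ih := ih (by omega)
    rw [pow_succ', mul_assoc, ← add_assoc]
    set st := fun ω => RepeatedSparsification.baseCase I (choices I ω) (i + 1) (n + 1) m (G ω) (X ω)
    have hadd : ∀ ω S, (∀ e ∈ I.A S,
        (e ∈ (st ω).free ↔ e ∈ (ideal I (choices I ω) i (n + m)).free)) →
        (S ∈ ({S ∈ G ω (n + 1 + m) | S ∉ (st ω).cover ∧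
          IsLarge I (choices I ω) (i + 1) (st ω) S} : Finset ι) ↔
        S ∈ (choices I ω).F (i + 1) (n + m + 1) ∧
          IsLarge I (choices I ω) (i + 1) (ideal I (choices I ω) i (n + m)) S) := by
      intro ω S hS
      rw [← isLarge_iff_of_agree hS, Finset.mem_filter]
      have htr := ((hG ω).mono hI (baseCase_free_subset (I := I) (c := choices I ω) (i + 1) (n + 1) m (G ω) (X ω)) le_rfl
        le_rfl) (n + 1 + m) (by omega) (by omega)
      rw [show n + m + 1 = n + 1 + m by omega]
      refine ⟨fun h => ⟨htr.1 h.1, h.2.2⟩, fun h => ⟨htr.2 S h.1 h.2, fun hc => ?_, h.2⟩⟩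
      exact h.2.not_disjoint hI (choices_proper ω)
        (((hX ω).baseCase hI (choices_proper ω) (i + 1) (n + 1) m (G ω)) S hc).2
    simp only [baseCase_succ]
    have h0 : Pr (coinProb I) (fun _ => False) ≤ 2 * failProb I := by
      rw [Pr_eq_zero fun _ => id]
      linarith [failProb_nonneg (I := I)]
    refine ih.step hI (two_failProb_le_pow_mul ha m) (fun _ _ => False) (fun _ _ => False)
      (fun _ => h0) (fun _ => h0) ?_ ?_
    · intro ω e he hS _
      rw [mem_addSets_free, mem_ideal_free_succ, he]
      refine and_congr_right fun _ => forall_congr' fun S => ?_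
      by_cases heS : e ∈ I.A S
      · rw [hadd ω S (hS S heS).2]
        simp [heS]
      · simp [heS]
    · intro ω S hS _ h2
      rw [mem_ideal_cover_succ, ← hS, ← hadd ω S h2]
      simp only [State.addSets, Finset.mem_union]
      rfl

theorem Close.recSplit (hI : Regular I) (hΛ : 2 ≤ I.Λ) {i : ℕ}
    (hi : i + 1 ∈ Finset.Icc 1 I.stages) (R : ℕ) :
    ∀ {n : ℕ}, n + R ≤ I.iterations →
    ∀ {G : (Coin I → Bool) → ℕ → Finset ι} {X : (Coin I → Bool) → State ι E} {a : ℝ},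
    Close I i n X a → 2 * failProb I ≤ a → (∀ ω, (X ω).Clean I) →
    (∀ ω, Tracks I (choices I ω) (i + 1) (G ω) (X ω) (n + 1) R) →
    Close I i (n + R) (fun ω => recSplit I (choices I ω) (i + 1) (n + 1) R (G ω) (X ω))
      (growth I ^ (R ^ 2) * a) := by
  induction R using Nat.strong_induction_on with
  | _ R ih =>
    intro n hR G X a h ha hX hG
    have ha0 : 0 ≤ a := le_trans (by linarith [failProb_nonneg (I := I)]) ha
    by_cases hb : R ≤ 1 ∨ (R : ℝ) ≤ Real.logb 2 (Real.logb 2 I.t)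
    · have : ∀ ω, RepeatedSparsification.recSplit I (choices I ω) (i + 1) (n + 1) R (G ω) (X ω) =
          RepeatedSparsification.baseCase I (choices I ω) (i + 1) (n + 1) R (G ω) (X ω) := by
        intro ω
        rw [RepeatedSparsification.recSplit, dif_pos hb]
      simp only [this]
      refine (h.baseCase hI ha hX hG le_rfl).mono (mul_le_mul_of_nonneg_right ?_ ha0)
      exact pow_le_pow_right₀ one_le_growth (Nat.le_self_pow two_ne_zero R)
    · set r := R / 2 with hr
      have hb1 : 1 < R := by
        rw [not_or, not_le] at hb
        exact hb.1
      set X₁ := fun ω => RepeatedSparsification.recSplit I (choices I ω) (i + 1) (n + 1) r (G ω) (X ω)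
        with hX₁
      set x := fun ω => RepeatedSparsification.sparsify I (choices I ω) (i + 1)
        (fun k => I.Λ ^ 10 * 2 ^ (k - (n + r + 1))) (n + r + 1) (R - r) (G ω) (X₁ ω) with hx
      have : ∀ ω, RepeatedSparsification.recSplit I (choices I ω) (i + 1) (n + 1) R (G ω) (X ω) =
          RepeatedSparsification.recSplit I (choices I ω) (i + 1) (n + r + 1) (R - r)
            (x ω).1 (x ω).2 := by
        intro ω
        rw [RepeatedSparsification.recSplit, dif_neg hb]
        simp only [hx, hX₁, show n + r + 1 = n + 1 + R / 2 by omega, ← hr]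
      simp only [this]
      have h1 : Close I i (n + r) X₁ (growth I ^ (r ^ 2) * a) :=
        ih r (by omega) (by omega) h ha hX fun ω => (hG ω).mono hI subset_rfl le_rfl (by omega)
      have hG₁ : ∀ ω, Tracks I (choices I ω) (i + 1) (G ω) (X₁ ω) (n + r + 1) (R - r) := fun ω =>
        (hG ω).mono hI (recSplit_free_subset ..) (by omega) (by omega)
      have h2 : Close I i (n + r) (fun ω => (x ω).2)
          (growth I ^ (R - r) * (growth I ^ (r ^ 2) * a)) :=
        h1.sparsify hI hΛ hi (by omega) (fun m => by rw [Nat.add_sub_cancel_left])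
          (two_failProb_le_pow_mul ha _) hG₁ le_rfl
      have h3 := ih (R - r) (by omega) (show n + r + (R - r) ≤ I.iterations by omega) h2
        (two_failProb_le_pow_mul (two_failProb_le_pow_mul ha _) _)
        (fun ω => ((hX ω).recSplit hI (choices_proper ω) _ _ _ _ _).sparsify _ _ _ _ _)
        (fun ω => (hG₁ ω).sparsify hI _)
      rw [show n + r + (R - r) = n + R by omega] at h3
      refine h3.mono ?_
      rw [← mul_assoc, ← mul_assoc, ← pow_add, ← pow_add]
      refine mul_le_mul_of_nonneg_right (pow_le_pow_right₀ one_le_growth ?_) ha0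
      obtain ⟨d, hd⟩ : ∃ d, R = r + d := ⟨R - r, by omega⟩
      have hr1 : 1 ≤ r := by omega
      rw [hd, Nat.add_sub_cancel_left]
      -- The halves of lengths $r$ and $d$ and the $d$ sparsification steps between them cost
      -- $r^2+d+d^2\le(r+d)^2$, as $r\ge1$.
      nlinarith [Nat.mul_le_mul_right d hr1]

theorem Close.stage (hI : Regular I) (hΛ : 2 ≤ I.Λ) {i : ℕ}
    (hi : i + 1 ∈ Finset.Icc 1 I.stages) {X : (Coin I → Bool) → State ι E} {a : ℝ}
    (h : Close I i 0 X a) (ha : 2 * failProb I ≤ a) (hX : ∀ ω, (X ω).Clean I) :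
    Close I (i + 1) 0 (fun ω => stage I (choices I ω) (X ω) (i + 1))
      (growth I ^ (1 + I.iterations + I.iterations ^ 2) * a) := by
  classical
  set L := I.iterations
  set Y : (Coin I → Bool) → Finset ι := fun ω =>
    {S | I.Λ ^ 10 ≤ (((choices I ω).B (i + 1) S ∩ (X ω).free).card : ℝ)}
  have hY : ∀ ω S, S ∈ Y ω ↔
      I.Λ ^ 10 ≤ (((choices I ω).B (i + 1) S ∩ (X ω).free).card : ℝ) := by
    intro ω S
    simp [Y]
  have h1 := h.cut hI hΛ hi ha hY
  have ha1 : 2 * failProb I ≤ growth I * a := by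
    simpa using two_failProb_le_pow_mul ha 1
  have hX1 : ∀ ω, ((X ω).addSets I.A (Y ω)).Clean I := fun ω =>
    (hX ω).cut hI (choices_proper ω) (i + 1) fun S hS => (hY ω S).1 hS
  have hG : ∀ ω, Tracks I (choices I ω) (i + 1) ((choices I ω).F (i + 1))
      ((X ω).addSets I.A (Y ω)) (0 + 1) L := fun ω k _ _ => ⟨subset_rfl, fun S hS _ => hS⟩
  -- The initial sparsification has twice the required threshold, since here $k=m+1$.
  have h2 := h1.sparsify hI hΛ hi (R := L) (by omega) (thr := fun k => I.Λ ^ 10 * 2 ^ k)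
    (fun m => by
      have := pow_pos hI.Λ_pos 10
      gcongr
      · norm_num
      · omega) ha1 hG le_rfl
  have h3 := Close.recSplit hI hΛ hi L (by omega) h2 (two_failProb_le_pow_mul ha1 _)
    (fun ω => (hX1 ω).sparsify _ _ _ _ _) (fun ω => (hG ω).sparsify hI L)
  rw [zero_add] at h3
  have h4 : growth I ^ L ^ 2 * (growth I ^ L * (growth I * a)) =
      growth I ^ (1 + L + L ^ 2) * a := by
    rw [pow_add, pow_add]; ring
  rw [h4] at h3
  exact ⟨h3.free, h3.cover⟩

theorem close_afterStages (hI : Regular I) (hΛ : 2 ≤ I.Λ) {i : ℕ} (hi : i ≤ I.stages) :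
    Close I i 0 (fun ω => afterStages I (choices I ω) i)
      (growth I ^ ((1 + I.iterations + I.iterations ^ 2) * i) * (2 * failProb I)) := by
  induction i with
  | zero =>
    -- The initial states coincide; the error starts at `2 * failProb I` so that every step can
    -- absorb its own exceptional events into the running bound.
    have h0 : (0 : ℝ) ≤ 2 * failProb I := by linarith [failProb_nonneg (I := I)]
    rw [mul_zero, pow_zero, one_mul]
    constructor <;> intro x <;> rw [Pr_eq_zero] <;>
      first | exact h0 | (intro ω h; exact h Iff.rfl)
  | succ i ih =>
    have := (ih (by omega)).stage hI hΛ (Finset.mem_Icc.2 ⟨by omega, hi⟩)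
      (two_failProb_le_pow_mul le_rfl _) fun ω => clean_afterStages hI (choices_proper ω) i
    simp only [afterStages_succ]
    refine this.mono (le_of_eq ?_)
    rw [mul_add, mul_one, pow_add]
    ring

end Coupling

section Conclusion

variable {ι E : Type*} [Fintype ι] [LinearOrder ι] [Fintype E] [DecidableEq E]
variable {I : Input ι E}

/-! ### The expected size of the cover -/

theorem stages_pos (hI : Regular I) : 0 < I.stages :=
  Nat.clog_pos (by norm_num) hI.two_le_s

theorem le_two_pow_stages : (I.s : ℝ) ≤ 2 ^ I.stages := by
  exact_mod_cast Nat.le_pow_clog (by norm_num) I.s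

theorem sampleProb_stages (hI : Regular I) : I.sampleProb I.stages = 1 := by
  refine min_eq_left ?_
  have h1 : (1 : ℝ) ≤ I.Λ ^ 5 := one_le_pow₀ hI.one_le
  have h2 : (1 : ℝ) ≤ 2 ^ I.stages / I.s := (one_le_div hI.s_pos).2 le_two_pow_stages
  nlinarith

/-- The idealised process covers all elements. -/
theorem freeProb_stages (hI : Regular I) (hcov : ∀ e, ∃ S, e ∈ I.A S) (e : E) :
    freeProb I I.stages 0 e = 0 := by
  have hp := hI.coinProb_mem
  obtain ⟨S, heS⟩ := hcov e
  obtain ⟨i, hi⟩ := Nat.exists_eq_add_one.2 (stages_pos hI)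
  obtain ⟨L, hL⟩ := Nat.exists_eq_add_one.2 (iterations_pos hI)
  have hi' : i + 1 ∈ Finset.Icc 1 I.stages := Finset.mem_Icc.2 ⟨by omega, hi.ge⟩
  have hk : L + 1 ∈ Finset.Icc 1 I.iterations := Finset.mem_Icc.2 ⟨by omega, hL.ge⟩
  -- In the last iteration of the last stage all sampling is exact and the largeness threshold is at
  -- most $1$, so every set with a free element is added, almost surely.
  have hpi : I.sampleProb (i + 1) = 1 := hi ▸ sampleProb_stages hI
  have h1 : Pr (coinProb I) (fun ω => ω (familyCoin hi' hk S) = false) = 0 :=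
    Pr_bit_false (show I.familyProb (L + 1) = 1 from hL ▸ familyProb_iterations hI)
  have h2 : Pr (coinProb I) (fun ω => ω (sampleCoin hi' S e) = false) = 0 := Pr_bit_false hpi
  refine le_antisymm ?_ (Pr_nonneg hp _)
  refine (Pr_mono hp fun ω hω => ?_).trans ((Pr_or_le hp _ _).trans (add_le_add h1.le h2.le |>.trans
    (add_zero 0).le))
  by_contra! h
  rw [hi, ← ideal_iterations, hL, mem_ideal_free_succ] at hω
  refine hω.2 S ((mem_choices_F hi' hk).2 (by simpa using h.1)) ?_ heS
  rw [isLarge_iff hI, hpi, mul_one]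
  have h3 : e ∈ (choices I ω).B (i + 1) S ∩ (ideal I (choices I ω) i L).free :=
    Finset.mem_inter.2 ⟨(mem_choices_B hi').2 ⟨heS, by simpa using h.2⟩, hω.1⟩
  have h4 : (1 : ℝ) ≤ ((choices I ω).B (i + 1) S ∩ (ideal I (choices I ω) i L).free).card := by
    exact_mod_cast Finset.card_pos.2 ⟨e, h3⟩
  have h5 : (I.s : ℝ) / 2 ^ (i + 1) ≤ 1 := by
    rw [div_le_one (by positivity), ← hi]
    exact le_two_pow_stages
  exact h5.trans h4

/-- The probability that the algorithm deviates from the idealised process at a given place. -/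
noncomputable def deviation (I : Input ι E) : ℝ :=
  growth I ^ ((1 + I.iterations + I.iterations ^ 2) * I.stages) * (2 * failProb I)

theorem deviation_nonneg : 0 ≤ deviation I :=
  mul_nonneg (pow_nonneg (zero_le_one.trans one_le_growth) _)
    (by linarith [failProb_nonneg (I := I)])

/-- The excess consists of sets that are only in the real cover and of clean-up sets, at most one
per uncovered element. Each of the two contributions is at most $t|E|$ times `deviation I`. -/
theorem expectedSize_le_ideal (hI : Regular I) (hΛ : 2 ≤ I.Λ) (hcov : ∀ e, ∃ S, e ∈ I.A S) :
    expectedSize I ≤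
      Ex (coinProb I) (fun ω => ((ideal I (choices I ω) I.stages 0).cover.card : ℝ)) +
        2 * (I.t * Fintype.card E * deviation I) := by
  classical
  have hp := hI.coinProb_mem
  have hclose : Close I I.stages 0 (fun ω => afterStages I (choices I ω) I.stages) (deviation I) :=
    close_afterStages hI hΛ le_rfl
  set X := fun ω => (afterStages I (choices I ω) I.stages).cover with hX
  set Y := fun ω => (ideal I (choices I ω) I.stages 0).cover with hY
  set D : ι → (Coin I → Bool) → Prop := fun S ω => ¬ (S ∈ X ω ↔ S ∈ Y ω) with hD
  set U : E → (Coin I → Bool) → Prop := fun e ω => ∀ S ∈ X ω, e ∉ I.A S with hU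
  have hDle : ∀ S, Pr (coinProb I) (D S) ≤ deviation I := hclose.cover
  -- The idealised cover almost surely contains a set covering `e`; if `e` is uncovered in reality,
  -- one of the at most `t` sets containing it deviates.
  have hUle : ∀ e, Pr (coinProb I) (U e) ≤ I.t * deviation I := by
    intro e
    have h1 : Pr (coinProb I) (fun ω => ∃ S ∈ ({S | e ∈ I.A S} : Finset ι), D S ω) ≤
        I.t * deviation I :=
      Pr_exists_le_mul hp _ _ (hI.degree_le e) deviation_nonneg fun S _ => hDle S
    have h2 : Pr (coinProb I) (fun ω => e ∈ (ideal I (choices I ω) I.stages 0).free ∨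
        ∃ S ∈ ({S | e ∈ I.A S} : Finset ι), D S ω) ≤ 0 + I.t * deviation I :=
      (Pr_or_le hp _ _).trans (add_le_add (freeProb_stages hI hcov e).le h1)
    rw [zero_add] at h2
    refine (Pr_mono hp fun ω hω => ?_).trans h2
    by_contra! h
    obtain ⟨h3, h4⟩ := h
    rw [mem_ideal_free_iff] at h3
    push Not at h3
    obtain ⟨S, hS, heS⟩ := h3
    have h5 := h4 S (by simpa using heS)
    simp only [hD, not_not] at h5
    exact hω S (h5.2 hS) heS
  have hpt : ∀ ω, ((solution I ω).card : ℝ) ≤ ((Y ω).card : ℝ) +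
      ((∑ S ∈ nonemptySets I, if D S ω then 1 else 0) + ∑ e, if U e ω then 1 else 0) := by
    intro ω
    have h1 : (solution I ω).card ≤ (X ω).card + (cleanUp I.A (X ω)).card := by
      rw [solution_eq]
      exact Finset.card_union_le _ _
    have h2 : (X ω).card ≤ (Y ω).card + ({S ∈ nonemptySets I | D S ω} : Finset ι).card := by
      refine (Finset.card_le_card fun S hS => ?_).trans (Finset.card_union_le _ _)
      rw [Finset.mem_union, Finset.mem_filter]
      by_cases hSY : S ∈ Y ω
      · exact Or.inl hSY
      · refine Or.inr ⟨?_, fun h => hSY (h.1 hS)⟩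
        simpa [nonemptySets] using (clean_afterStages hI (choices_proper ω) _ S hS).1
    have h3 : (cleanUp I.A (X ω)).card ≤ ({e | U e ω} : Finset E).card := by
      convert card_cleanUp_le I.A (X ω)
    rw [Finset.sum_boole, Finset.sum_boole]
    exact_mod_cast (by omega : (solution I ω).card ≤ (Y ω).card +
      (({S ∈ nonemptySets I | D S ω} : Finset ι).card + ({e | U e ω} : Finset E).card))
  rw [hI.expectedSize_eq]
  refine (Ex_mono hp hpt).trans ?_
  rw [Ex_add, Ex_add, Ex_sum, Ex_sum]
  have h4 : ∑ S ∈ nonemptySets I, Ex (coinProb I) (fun ω => if D S ω then 1 else 0) ≤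
      I.t * Fintype.card E * deviation I := by
    refine (Finset.sum_le_card_nsmul _ _ _ fun S _ => (Pr_eq_Ex (D S)).symm.trans_le (hDle S)).trans ?_
    rw [nsmul_eq_mul]
    exact mul_le_mul_of_nonneg_right (card_nonemptySets_le hI) deviation_nonneg
  have h5 : ∑ e, Ex (coinProb I) (fun ω => if U e ω then 1 else 0) ≤
      I.t * Fintype.card E * deviation I := by
    refine (Finset.sum_le_card_nsmul _ _ _ fun e _ => (Pr_eq_Ex (U e)).symm.trans_le (hUle e)).trans_eq ?_
    rw [nsmul_eq_mul, Finset.card_univ]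
    ring
  linarith

/-! ### Numerical estimates -/

theorem one_le_logb_two {n : ℕ} (hn : 2 ≤ n) : (1 : ℝ) ≤ Real.logb 2 n := by
  rw [Real.le_logb_iff_rpow_le (by norm_num) (by positivity), Real.rpow_one]
  exact_mod_cast hn

theorem clog_le_two_mul_logb {n : ℕ} (hn : 2 ≤ n) :
    (Nat.clog 2 n : ℝ) ≤ 2 * Real.logb 2 n := by
  have h1 := one_le_logb_two hn
  have h2 := Real.natCeil_logb_natCast 2 n
  have h3 := Nat.ceil_lt_add_one (zero_le_one.trans h1)
  rw [Nat.cast_ofNat] at h2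
  rw [h2] at h3
  linarith

theorem mul_le_rpow (hI : Regular I) (h : Real.logb 2 (I.s * I.t) / 2 ≤ I.Λ) :
    (I.s : ℝ) * I.t ≤ 4 ^ I.Λ := by
  have hs := hI.s_pos
  have ht := hI.t_pos
  have h1 : Real.logb 2 (I.s * I.t) ≤ 2 * I.Λ := by linarith
  rw [Real.logb_le_iff_le_rpow (by norm_num) (by positivity), Real.rpow_mul (by norm_num)] at h1
  norm_num at h1
  exact h1

theorem four_rpow_le {x : ℝ} (hx : 0 ≤ x) : (4 : ℝ) ^ x ≤ Real.exp (2 * x) := by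
  have h : (4 : ℝ) ≤ Real.exp 2 := by
    have h1 : Real.exp 2 = Real.exp 1 * Real.exp 1 := by rw [← Real.exp_add]; norm_num
    nlinarith [Real.exp_one_gt_d9]
  rw [Real.exp_mul]
  exact Real.rpow_le_rpow (by norm_num) h hx

/-- The numerical consequences of `Λ` being large. -/
theorem estimates (hI : Regular I) (h : Real.logb 2 (I.s * I.t) / 2 ≤ I.Λ) (hΛ : 600 ≤ I.Λ) :
    2 * (I.s * I.t * deviation I) ≤ 1 ∧ I.iterations * (I.s * I.t * failProb I) ≤ 1 ∧
      2 ^ I.stages * failProb I ≤ 1 := by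
  have hs := hI.s_pos
  have ht := hI.t_pos
  have hs2 : (2 : ℝ) ≤ I.s := by exact_mod_cast hI.two_le_s
  have ht2 : (2 : ℝ) ≤ I.t := by exact_mod_cast hI.two_le_t
  have hΛ0 : 0 ≤ I.Λ := hI.Λ_pos.le
  have hst : (I.s : ℝ) * I.t ≤ Real.exp (2 * I.Λ) :=
    (mul_le_rpow hI h).trans (four_rpow_le hΛ0)
  have hlog : Real.logb 2 I.s + Real.logb 2 I.t ≤ 2 * I.Λ := by
    rw [← Real.logb_mul hs.ne' ht.ne']
    linarith
  have hlog_s := one_le_logb_two hI.two_le_s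
  have hlog_t := one_le_logb_two hI.two_le_t
  have hstages : (I.stages : ℝ) ≤ 4 * I.Λ :=
    (clog_le_two_mul_logb hI.two_le_s).trans (by linarith)
  have hiter : (I.iterations : ℝ) ≤ 4 * I.Λ :=
    (clog_le_two_mul_logb hI.two_le_t).trans (by linarith)
  have hexp : ∀ x : ℝ, x ≤ Real.exp x := fun x => by linarith [Real.add_one_le_exp x]
  have hgrowth : growth I ≤ Real.exp (3 * I.Λ) := by
    have h1 : growth I ≤ 2 * (I.s * I.t) := by rw [growth]; nlinarith
    have h2 : (2 : ℝ) ≤ Real.exp I.Λ := le_trans (by linarith) (hexp _)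
    calc growth I ≤ 2 * (I.s * I.t) := h1
      _ ≤ Real.exp I.Λ * Real.exp (2 * I.Λ) := by gcongr
      _ = Real.exp (3 * I.Λ) := by rw [← Real.exp_add]; congr 1; ring
  -- The largest exponent below is $3\Lambda+252\Lambda^4\le300\Lambda^4$; this inequality bounds it
  -- by $\Lambda^5/2$.
  have h4 : 600 * I.Λ ^ 4 ≤ I.Λ ^ 5 := by
    have := mul_le_mul_of_nonneg_right hΛ (pow_nonneg hΛ0 4)
    linarith [show I.Λ * I.Λ ^ 4 = I.Λ ^ 5 by ring]
  have h1Λ : 1 ≤ I.Λ := hI.one_le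
  have h14 : I.Λ ≤ I.Λ ^ 4 := le_self_pow₀ h1Λ (by norm_num)
  have hpow : growth I ^ ((1 + I.iterations + I.iterations ^ 2) * I.stages) ≤
      Real.exp (252 * I.Λ ^ 4) := by
    calc growth I ^ ((1 + I.iterations + I.iterations ^ 2) * I.stages) ≤
        Real.exp (3 * I.Λ) ^ ((1 + I.iterations + I.iterations ^ 2) * I.stages) :=
          pow_le_pow_left₀ (zero_le_one.trans one_le_growth) hgrowth _
      _ = Real.exp (((1 + (I.iterations : ℝ) + (I.iterations : ℝ) ^ 2) * I.stages) *
          (3 * I.Λ)) := by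
          rw [← Real.exp_nat_mul]
          push_cast
          rfl
      _ ≤ Real.exp (252 * I.Λ ^ 4) := by
          refine Real.exp_le_exp.2 ?_
          -- With at most $4\Lambda$ iterations, $1+4\Lambda+16\Lambda^2\le21\Lambda^2$; then
          -- $252=21\cdot4\cdot3$ includes the stages and the exponent of `growth`.
          have h5 : 1 + (I.iterations : ℝ) + (I.iterations : ℝ) ^ 2 ≤ 21 * I.Λ ^ 2 := by
            have h6 : (I.iterations : ℝ) ^ 2 ≤ (4 * I.Λ) ^ 2 := by gcongr
            have h7 : I.Λ ≤ I.Λ ^ 2 := le_self_pow₀ h1Λ (by norm_num)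
            nlinarith
          calc (1 + (I.iterations : ℝ) + (I.iterations : ℝ) ^ 2) * I.stages * (3 * I.Λ) ≤
              (21 * I.Λ ^ 2) * (4 * I.Λ) * (3 * I.Λ) := by gcongr
            _ = 252 * I.Λ ^ 4 := by ring
  refine ⟨?_, ?_, ?_⟩
  · calc 2 * (I.s * I.t * deviation I) = 4 * (I.s * I.t) *
          growth I ^ ((1 + I.iterations + I.iterations ^ 2) * I.stages) * failProb I := by
          rw [deviation]; ring
      _ ≤ Real.exp I.Λ * Real.exp (2 * I.Λ) * Real.exp (252 * I.Λ ^ 4) *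
          Real.exp (-(I.Λ ^ 5 / 2)) := by
          have h2 : (4 : ℝ) ≤ Real.exp I.Λ := le_trans (by linarith) (hexp _)
          have h3 := failProb_nonneg (I := I)
          have h5 := zero_le_one.trans (one_le_growth (I := I))
          rw [failProb]
          gcongr
      _ ≤ 1 := by
          rw [← Real.exp_add, ← Real.exp_add, ← Real.exp_add, Real.exp_le_one_iff]
          linarith
  · calc I.iterations * (I.s * I.t * failProb I) ≤
          Real.exp (4 * I.Λ) * (Real.exp (2 * I.Λ) * Real.exp (-(I.Λ ^ 5 / 2))) := by
          have := hiter.trans (hexp _)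
          rw [failProb]
          gcongr
      _ ≤ 1 := by
          rw [← Real.exp_add, ← Real.exp_add, Real.exp_le_one_iff]
          linarith
  · calc 2 ^ I.stages * failProb I ≤ Real.exp 1 ^ I.stages * Real.exp (-(I.Λ ^ 5 / 2)) := by
          have : (2 : ℝ) ≤ Real.exp 1 := by linarith [Real.exp_one_gt_d9]
          rw [failProb]
          gcongr
      _ ≤ 1 := by
          rw [← Real.exp_nat_mul, ← Real.exp_add, Real.exp_le_one_iff]
          linarith

theorem expectedSize_le_of_large (hI : Regular I) (hcov : ∀ e, ∃ S, e ∈ I.A S)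
    (h : Real.logb 2 (I.s * I.t) / 2 ≤ I.Λ) (hΛ : 600 ≤ I.Λ) {x : ι → ℝ}
    (hx : IsFractionalCover I.A x) :
    expectedSize I ≤ 292 * Real.logb 2 I.s * ∑ S, x S := by
  obtain ⟨h1, h2, h3⟩ := estimates hI h hΛ
  have hX : 0 ≤ ∑ S, x S := Finset.sum_nonneg fun S _ => hx.1 S
  have hE := card_le_mul_sum hI hx
  have hδ := failProb_nonneg (I := I)
  have hdev := deviation_nonneg (I := I)
  have hstages : (1 : ℝ) ≤ I.stages := by exact_mod_cast stages_pos hI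
  have hlog : (I.stages : ℝ) ≤ 2 * Real.logb 2 I.s := clog_le_two_mul_logb hI.two_le_s
  have e1 : 2 * (I.t * Fintype.card E * deviation I) ≤ ∑ S, x S := by
    calc 2 * (I.t * Fintype.card E * deviation I) ≤
        2 * (I.t * (I.s * ∑ S, x S) * deviation I) := by gcongr
      _ = 2 * (I.s * I.t * deviation I) * ∑ S, x S := by ring
      _ ≤ 1 * ∑ S, x S := by gcongr
      _ = ∑ S, x S := one_mul _
  have e2 : I.iterations * (I.t * Fintype.card E * failProb I) ≤ ∑ S, x S := by
    calc I.iterations * (I.t * Fintype.card E * failProb I) ≤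
        I.iterations * (I.t * (I.s * ∑ S, x S) * failProb I) := by gcongr
      _ = I.iterations * (I.s * I.t * failProb I) * ∑ S, x S := by ring
      _ ≤ 1 * ∑ S, x S := by gcongr
      _ = ∑ S, x S := one_mul _
  have e3 : (128 + 16 * 2 ^ I.stages * failProb I) * ∑ S, x S ≤ 144 * ∑ S, x S := by
    gcongr
    linarith
  calc expectedSize I ≤ _ := expectedSize_le_ideal hI (by linarith) hcov
    _ ≤ I.stages * (∑ S, x S + 144 * ∑ S, x S) + ∑ S, x S := by
        refine add_le_add ((Ex_card_ideal_cover_le hI hx).trans ?_) e1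
        gcongr
    _ ≤ I.stages * (∑ S, x S + 144 * ∑ S, x S) + I.stages * ∑ S, x S := by
        gcongr
        exact le_mul_of_one_le_left hX hstages
    -- $146=1+144+1$: the idealised failures, the load bound $128+16$, and the deviation term;
    -- rounding up $\log_2 s$ then doubles it to $292$.
    _ = 146 * I.stages * ∑ S, x S := by ring
    _ ≤ 146 * (2 * Real.logb 2 I.s) * ∑ S, x S := by gcongr
    _ = _ := by ring

/-- Only nonempty sets are ever returned, and there are at most $t|E|\le st\sum_S x_S$ of them, with
$st\le4^\Lambda\le4^{600}$. -/
theorem expectedSize_le_of_small (hI : Regular I) (h : Real.logb 2 (I.s * I.t) / 2 ≤ I.Λ)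
    (hΛ : I.Λ ≤ 600) {x : ι → ℝ} (hx : IsFractionalCover I.A x) :
    expectedSize I ≤ (4 : ℝ) ^ (600 : ℝ) * Real.logb 2 I.s * ∑ S, x S := by
  have hX : 0 ≤ ∑ S, x S := Finset.sum_nonneg fun S _ => hx.1 S
  have hlog := one_le_logb_two hI.two_le_s
  have h0 : (0 : ℝ) ≤ (4 : ℝ) ^ (600 : ℝ) := by positivity
  calc expectedSize I ≤ I.t * Fintype.card E := by
        rw [hI.expectedSize_eq, ← Ex_const (p := coinProb I) ((I.t : ℝ) * Fintype.card E)]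
        refine Ex_mono hI.coinProb_mem fun ω => le_trans ?_ (card_nonemptySets_le hI)
        exact_mod_cast Finset.card_le_card (solution_subset hI ω)
    _ ≤ I.t * (I.s * ∑ S, x S) := by
        gcongr
        exact card_le_mul_sum hI hx
    _ = I.s * I.t * 1 * ∑ S, x S := by ring
    _ ≤ (4 : ℝ) ^ (600 : ℝ) * Real.logb 2 I.s * ∑ S, x S := by
        have h1 : (I.s : ℝ) * I.t ≤ (4 : ℝ) ^ (600 : ℝ) :=
          (mul_le_rpow hI h).trans (Real.rpow_le_rpow_of_exponent_le (by norm_num) hΛ)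
        gcongr

/-- The all-ones vector is a fractional cover, so the infimum is over a nonempty set and inherits
the bound; attainment is not needed. -/
theorem le_mul_opt {A : ι → Finset E} (hcov : ∀ e, ∃ S, e ∈ A S) {v c : ℝ} (hc : 0 < c)
    (h : ∀ x, IsFractionalCover A x → v ≤ c * ∑ S, x S) : v ≤ c * opt A := by
  rw [← div_le_iff₀' hc]
  refine le_csInf ⟨_, fun _ => 1, ⟨fun _ => zero_le_one, fun e => ?_⟩, rfl⟩ ?_
  · obtain ⟨S, hS⟩ := hcov e
    rw [Finset.sum_const, nsmul_eq_mul, mul_one]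
    exact_mod_cast Finset.card_pos.2 ⟨S, by simpa using hS⟩
  · rintro _ ⟨x, hx, rfl⟩
    rw [div_le_iff₀' hc]
    exact h x hx

end Conclusion

end RepeatedSparsification

/-! ### The main theorem. -/

theorem mainTheorem6 :
    ∃ C : ℝ, 0 < C ∧
      ∀ (ι : Type*) (E : Type*) [Fintype ι] [LinearOrder ι] [Fintype E] [DecidableEq E]
        (A : ι → Finset E) (s t : ℕ) (Λ : ℝ),
        2 ≤ s → 2 ≤ t →
        (∀ S, (A S).card ≤ s) →
        (∀ e, RepeatedSparsification.elemDegree A Finset.univ e ≤ t) →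
        (∀ e, ∃ S, e ∈ A S) →
        Real.logb 2 (s * t) / 2 ≤ Λ →
        (∀ ω, RepeatedSparsification.IsSetCover A
          (RepeatedSparsification.solution ⟨A, s, t, Λ⟩ ω)) ∧
        RepeatedSparsification.expectedSize ⟨A, s, t, Λ⟩ ≤
          C * Real.logb 2 s * RepeatedSparsification.opt A := by
  have h4 : (0 : ℝ) < (4 : ℝ) ^ (600 : ℝ) := by positivity
  refine ⟨292 + (4 : ℝ) ^ (600 : ℝ), by positivity, ?_⟩
  intro ι E _ _ _ _ A s t Λ hs ht hA hdeg hcov hΛ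
  have hlog_s := RepeatedSparsification.one_le_logb_two hs
  have hlog_t := RepeatedSparsification.one_le_logb_two ht
  have hs0 : (s : ℝ) ≠ 0 := by positivity
  have ht0 : (t : ℝ) ≠ 0 := by positivity
  -- Both logarithms are at least $1$, so half their sum is too.
  have hone : 1 ≤ Λ := by
    rw [Real.logb_mul hs0 ht0] at hΛ
    linarith
  have hI : RepeatedSparsification.Regular (⟨A, s, t, Λ⟩ : RepeatedSparsification.Input ι E) :=
    ⟨hs, ht, hA, hdeg, hone⟩
  refine ⟨RepeatedSparsification.isSetCover_solution hcov, ?_⟩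
  refine RepeatedSparsification.le_mul_opt hcov (by positivity) fun x hx => ?_
  have hX : 0 ≤ ∑ S, x S := Finset.sum_nonneg fun S _ => hx.1 S
  rcases le_total Λ 600 with h | h
  · refine (RepeatedSparsification.expectedSize_le_of_small hI hΛ h hx).trans ?_
    gcongr
    exact le_add_of_nonneg_left (by norm_num)
  · refine (RepeatedSparsification.expectedSize_le_of_large hI hcov hΛ h hx).trans ?_
    gcongr
    exact le_add_of_nonneg_right h4.le
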